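/- Let $\mathscr C$ be a finite category (finitely many objects and morphisms) that is skeletal (distinct objects are not isomorphic) and is an EI-category (every endomorphism is an isomorphism, so each $\mathscr C(c,c)$ is a finite group, with product $gh=g\circ h$). Let $k$ be a field such that, for every object $c$, the characteristic of $k$ does not divide $|\mathscr C(c,c)|$ and $k$ is a splitting field for $\mathscr C(c,c)$. Here a finite-dimensional $k$-algebra $A$ splits over $k$ if $A/\operatorname{rad}(A)$ is isomorphic to a finite product of matrix algebras over $k$, and $k$ is a splitting field for a group $G$ if $kG$ splits over $k$. The category algebra $k\mathscr C$ has the morphisms of $\mathscr C$ as a basis, with product extending composition bilinearly, undefined composites being $0$. The quiver $Q(A)$ of an algebra $A$ that splits over $k$ has as vertices the isomorphism classes of simple left $A$-modules, and $\dim_k\operatorname{Ext}^1_A(S,T)$ arrows from $S$ to $T$. Write $\operatorname{Irr}(G)$ for the set of isomorphism classes of simple $kG$-modules. A morphism $f$ is irreducible if it is neither a split monomorphism nor a split epimorphism and whenever $f=gh$, either $h$ is a split monomorphism or $g$ is a split epimorphism; $\mathsf{Irr}_{\mathscr C}(c,c')$ is the set of irreducible morphisms $c\to c'$, on which $\mathscr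 C(c',c')\times\mathscr C(c,c)$ acts by $(g,h)\cdot f=gfh^{-1}$. Then $k\mathscr C$ splits over $k$, and: 1. The vertex set of $Q(k\mathscr C)$ is $\coprod_{c}\operatorname{Irr}(\mathscr C(c,c))$, the union being over the objects $c$ of $\mathscr C$: sending a simple $k\mathscr C(c,c)$-module $U$ to the $k\mathscr C$-module with the same underlying space, on which the elements of $\mathscr C(c,c)$ act as on $U$ and all other morphisms act as $0$, induces a bijection from $\coprod_c\operatorname{Irr}(\mathscr C(c,c))$ onto the set of isomorphism classes of simple $k\mathscr C$-modules. 2. If $U\in\operatorname{Irr}(\mathscr C(c,c))$ and $V\in\operatorname{Irr}(\mathscr C(c',c'))$, then the number of arrows from $U$ to $V$ in $Q(k\mathscr C)$ is the multiplicity of $V\otimes_k U^*$ as an irreducible constituent of the $\mathscr C(c',c')\times\mathscr C(c,c)$-module $k[\mathsf{Irr}_{\mathscr C}(c,c')]$, where $U^*=\operatorname{Hom}_k(U,k)$ is the contragredient module. -/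

import Mathlib

universe t u v w

namespace EIQuiver

open CategoryTheory
open scoped MonoidAlgebra

noncomputable section

/-! ### Finite-dimensional algebras and their quivers -/

/-- A `k`-algebra `A` splits over `k` if `A / rad A` is isomorphic, as a `k`-algebra, to a finite
product of full matrix algebras over `k`. -/
def IsSplit (k : Type u) (A : Type v) [Field k] [Ring A] [Algebra k A] : Prop :=
  ∃ (n : ℕ) (d : Fin n → ℕ), Nonempty
    ((A ⧸ Ring.jacobson A) ≃ₐ[k] ((i : Fin n) → Matrix (Fin (d i)) (Fin (d i)) k))

/-- `k` is a splitting field for the group `G` if the group algebra `kG` splits over `k`. -/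
def IsSplittingField (k : Type u) (G : Type v) [Field k] [Group G] : Prop :=
  IsSplit k k[G]

/-- The simple left `A`-modules. -/
abbrev SimpleMod (A : Type v) [Ring A] : Type (max (t + 1) v) :=
  {S : ModuleCat.{t} A // IsSimpleModule A S}

/-- Isomorphism of simple left `A`-modules. -/
instance simpleModSetoid (A : Type v) [Ring A] : Setoid (SimpleMod.{t} A) where
  r S T := Nonempty (S.1 ≅ T.1)
  iseqv := ⟨fun S => ⟨Iso.refl S.1⟩, fun ⟨e⟩ => ⟨e.symm⟩, fun ⟨e⟩ ⟨f⟩ => ⟨e ≪≫ f⟩⟩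

/-- The set of isomorphism classes of simple left `A`-modules; this is the vertex set of the
(Gabriel) quiver `Q(A)`. For a group `G` with group algebra `kG`, the set `Irr(G)` is `Irr kG`. -/
def Irr (A : Type v) [Ring A] : Type (max (t + 1) v) :=
  Quotient (simpleModSetoid.{t} A)

/-- The class of a simple module. -/
def Irr.mk {A : Type v} [Ring A] (S : SimpleMod.{t} A) : Irr.{t} A := Quotient.mk _ S

section Arrows

variable (k : Type u) (A : Type v) [Field k] [Ring A] [Algebra k A] [Small.{t} A]

/-- Isomorphic modules have isomorphic `Ext¹` spaces. -/
def extCongr {S S' T T' : ModuleCat.{t} A} (e : S ≅ S') (f : T ≅ T') :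
    Abelian.Ext S T 1 ≃ₗ[k] Abelian.Ext S' T' 1 :=
  LinearEquiv.ofLinearMap
    ((Abelian.Ext.precompOfLinear (Abelian.Ext.mk₀ e.inv) k T' (zero_add 1)).comp
      (Abelian.Ext.postcompOfLinear (Abelian.Ext.mk₀ f.hom) k S (add_zero 1)))
    ((Abelian.Ext.precompOfLinear (Abelian.Ext.mk₀ e.hom) k T (zero_add 1)).comp
      (Abelian.Ext.postcompOfLinear (Abelian.Ext.mk₀ f.inv) k S' (add_zero 1)))
    (by ext x; simp)
    (by ext x; simp)

/-- The number of arrows `x → y` in the quiver `Q(A)`: the dimension over `k` of `Ext¹_A(S, T)`,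
where `S` and `T` are simple modules in the classes `x` and `y`. -/
def numArrows : Irr.{t} A → Irr.{t} A → ℕ∞ :=
  Quotient.lift₂ (fun S T => Cardinal.toENat (Module.rank k (Abelian.Ext S.1 T.1 1)))
    (by
      rintro S T S' T' ⟨e⟩ ⟨f⟩
      exact congrArg _ (extCongr k A e f).rank_eq)

end Arrows

/-- The multiplicity of the simple module `T` as an irreducible constituent of the semisimple
module `W`: the number of simple summands in the `T`-isotypic component of `W`. -/
def multiplicity (R : Type u) (W : Type v) (T : Type w) [Ring R] [AddCommGroup W] [Module R W]
    [AddCommGroup T] [Module R T] : ℕ∞ :=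
  Module.length R (isotypicComponent R W T)

open scoped ModuleCat in
/-- For a left `kH`-module `V` and a left `kG`-module `U`, the representation of `H × G` on
`V ⊗ U*`, where `U* = Hom_k(U, k)` is the contragredient of `U`. -/
def tensorDual (k : Type w) {H : Type u} {G : Type v} [Field k] [Group H] [Group G]
    (V : ModuleCat.{t} k[H]) (U : ModuleCat.{t} k[G]) :
    Representation k (H × G) (TensorProduct k V (Module.Dual k U)) :=
  Representation.tprod
    ((Representation.ofModule' (k := k) V).comp (MonoidHom.fst H G))
    ((Representation.ofModule' (k := k) U).dual.comp (MonoidHom.snd H G))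

open scoped ModuleCat in
lemma tensorDual_tmul (k : Type w) {H : Type u} {G : Type v} [Field k] [Group H] [Group G]
    (V : ModuleCat.{t} k[H]) (U : ModuleCat.{t} k[G]) (p : H × G) (x : V) (f : Module.Dual k U) :
    tensorDual k V U p (TensorProduct.tmul k x f) =
      TensorProduct.tmul k (MonoidAlgebra.of k H p.1 • x)
        ((Representation.ofModule' (k := k) U).dual p.2 f) := rfl

open scoped ModuleCat in
lemma dual_ofModule'_apply (k : Type w) {G : Type v} [Field k] [Group G]
    (U : ModuleCat.{t} k[G]) (g : G) (f : Module.Dual k U) (x : U) :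
    (Representation.ofModule' (k := k) U).dual g f x = f (MonoidAlgebra.of k G g⁻¹ • x) := rfl

/-! ### EI-categories -/

/-- An EI-category is a category in which every endomorphism is an isomorphism. -/
class IsEI (C : Type u) [Category.{v} C] : Prop where
  isIso_endo : ∀ {c : C} (f : c ⟶ c), IsIso f

/-- In an EI-category the monoid `C(c, c)` is a group, under composition of functions
(`g * f = f ≫ g`). -/
instance endGroup {C : Type u} [Category.{v} C] [IsEI C] (c : C) : Group (End c) where
  __ := End.monoid
  inv f := @inv _ _ _ _ f.asHom (IsEI.isIso_endo f.asHom)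
  inv_mul_cancel f := by
    have := IsEI.isIso_endo f.asHom
    exact IsIso.hom_inv_id f.asHom

/-- A morphism is irreducible if it is neither a split monomorphism nor a split epimorphism, and
whenever it factors as `h` followed by `g`, either `h` is a split monomorphism or `g` is a split
epimorphism. -/
structure IsIrredHom {C : Type u} [Category.{v} C] {c d : C} (f : c ⟶ d) : Prop where
  not_splitMono : ¬ IsSplitMono f
  not_splitEpi : ¬ IsSplitEpi f
  splitMono_or_splitEpi : ∀ {e : C} (h : c ⟶ e) (g : e ⟶ d), f = h ≫ g →
    IsSplitMono h ∨ IsSplitEpi g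

/-- The set of irreducible morphisms from `c` to `d`. -/
abbrev IrredHom {C : Type u} [Category.{v} C] (c d : C) : Type v :=
  {f : c ⟶ d // IsIrredHom f}

lemma isSplitMono_of_comp {C : Type u} [Category.{v} C] {a b c : C} (f : a ⟶ b) (g : b ⟶ c)
    (h : IsSplitMono (f ≫ g)) : IsSplitMono f :=
  ⟨⟨⟨g ≫ retraction (f ≫ g), by rw [← Category.assoc, IsSplitMono.id]⟩⟩⟩

lemma isSplitEpi_of_comp {C : Type u} [Category.{v} C] {a b c : C} (f : a ⟶ b) (g : b ⟶ c)
    (h : IsSplitEpi (f ≫ g)) : IsSplitEpi g :=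
  ⟨⟨⟨section_ (f ≫ g) ≫ f, by rw [Category.assoc, IsSplitEpi.id]⟩⟩⟩

lemma IsIrredHom.iso_comp_iso {C : Type u} [Category.{v} C] {c d c' d' : C} {f : c ⟶ d}
    (hf : IsIrredHom f) (a : c' ⟶ c) (b : d ⟶ d') [IsIso a] [IsIso b] :
    IsIrredHom (a ≫ f ≫ b) where
  not_splitMono h := hf.not_splitMono (by
    have h1 : IsSplitMono (inv a ≫ a ≫ f ≫ b) := inferInstance
    rw [IsIso.inv_hom_id_assoc] at h1
    exact isSplitMono_of_comp f b h1)
  not_splitEpi h := hf.not_splitEpi (by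
    have h1 : IsSplitEpi ((a ≫ f ≫ b) ≫ inv b) := inferInstance
    rw [Category.assoc, Category.assoc, IsIso.hom_inv_id, Category.comp_id] at h1
    exact isSplitEpi_of_comp a f h1)
  splitMono_or_splitEpi {e} h g hfac := by
    have key : f = (inv a ≫ h) ≫ (g ≫ inv b) := by
      rw [Category.assoc, ← Category.assoc h, ← hfac]
      simp
    rcases hf.splitMono_or_splitEpi _ _ key with h1 | h1
    · left
      have h2 : IsSplitMono (a ≫ inv a ≫ h) := inferInstance
      rwa [IsIso.hom_inv_id_assoc] at h2
    · right
      have h2 : IsSplitEpi ((g ≫ inv b) ≫ b) := inferInstance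
      rwa [Category.assoc, IsIso.inv_hom_id, Category.comp_id] at h2

/-- The group `C(d, d) × C(c, c)` acts on the irreducible morphisms from `c` to `d` by sending `f`
to the composite of `h⁻¹`, `f` and `g`, in this order. -/
instance irredHomMulAction {C : Type u} [Category.{v} C] [IsEI C] (c d : C) :
    MulAction (End d × End c) (IrredHom c d) where
  smul p f := ⟨(p.2⁻¹).asHom ≫ f.1 ≫ p.1.asHom,
    have := IsEI.isIso_endo (p.2⁻¹).asHom
    have := IsEI.isIso_endo p.1.asHom
    f.2.iso_comp_iso _ _⟩
  one_smul f := by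
    apply Subtype.ext
    change ((1 : End c)⁻¹).asHom ≫ f.1 ≫ 𝟙 d = f.1
    rw [inv_one]
    simp
  mul_smul p q f := by
    apply Subtype.ext
    change ((p.2 * q.2)⁻¹).asHom ≫ f.1 ≫ (p.1 * q.1).asHom =
      (p.2⁻¹).asHom ≫ ((q.2⁻¹).asHom ≫ f.1 ≫ q.1.asHom) ≫ p.1.asHom
    rw [mul_inv_rev]
    simp

/-! ### The category algebra -/

/-- The category algebra `kC` of a category `C` with finitely many objects: an element is a family
of formal `k`-linear combinations of morphisms `c ⟶ d`, one for each pair of objects `c`, `d`. So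
the morphisms of `C` form a basis of `kC` (see `CategoryAlgebra.single`). -/
def CategoryAlgebra (k : Type w) (C : Type u) [Field k] [Category.{v} C] : Type (max u v w) :=
  (c d : C) → ((c ⟶ d) →₀ k)

namespace CategoryAlgebra

variable {k : Type w} {C : Type u} [Field k] [Category.{v} C]

instance : AddCommGroup (CategoryAlgebra k C) :=
  inferInstanceAs (AddCommGroup ((c d : C) → ((c ⟶ d) →₀ k)))

instance : Module k (CategoryAlgebra k C) :=
  inferInstanceAs (Module k ((c d : C) → ((c ⟶ d) →₀ k)))

/-- The component of `x` in the span of the morphisms from `c` to `d`, as a morphism of the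
`k`-linear category `Free k C`. -/
def hom (x : CategoryAlgebra k C) (c d : C) : Free.of k c ⟶ Free.of k d := x c d

@[ext]
lemma ext {x y : CategoryAlgebra k C} (h : ∀ c d, x.hom c d = y.hom c d) : x = y :=
  funext fun c => funext fun d => h c d

@[simp] lemma hom_add (x y : CategoryAlgebra k C) (c d : C) :
    (x + y).hom c d = x.hom c d + y.hom c d := rfl

@[simp] lemma hom_zero (c d : C) : (0 : CategoryAlgebra k C).hom c d = 0 := rfl

@[simp] lemma hom_smul (r : k) (x : CategoryAlgebra k C) (c d : C) :
    (r • x).hom c d = r • x.hom c d := rfl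

/-- The scalar multiple `r f` of the basis element `f` of `kC`. -/
def single {c d : C} (f : c ⟶ d) (r : k) : CategoryAlgebra k C :=
  open Classical in
  Pi.single (M := fun c => (d : C) → ((c ⟶ d) →₀ k)) c
    (Pi.single (M := fun d => ((c ⟶ d) →₀ k)) d (Finsupp.single f r))

/-- The identity of `kC` is the sum of the identity morphisms. -/
instance : One (CategoryAlgebra k C) where
  one := open Classical in
    fun c d => if h : c = d then Finsupp.single (eqToHom h) 1 else 0

lemma hom_one_self (c : C) : (1 : CategoryAlgebra k C).hom c c = 𝟙 (Free.of k c) :=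
  dif_pos rfl

lemma hom_one_of_ne {c d : C} (h : c ≠ d) : (1 : CategoryAlgebra k C).hom c d = 0 :=
  dif_neg h

lemma hom_single_self {c d : C} (f : c ⟶ d) (r : k) :
    (single f r).hom c d = Finsupp.single f r := by
  simp only [single, hom, Pi.single_eq_same]
  rfl

lemma hom_single_of_ne_left {c d a : C} (f : c ⟶ d) (r : k) (b : C) (h : a ≠ c) :
    (single f r).hom a b = 0 := by
  classical
  simp only [single, hom]
  rw [Pi.single_eq_of_ne h]
  rfl

lemma hom_single_of_ne_right {c d b : C} (f : c ⟶ d) (r : k) (a : C) (h : b ≠ d) :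
    (single f r).hom a b = 0 := by
  classical
  by_cases ha : a = c
  · subst ha
    simp only [single, hom, Pi.single_eq_same]
    rw [Pi.single_eq_of_ne h]
    rfl
  · exact hom_single_of_ne_left f r b ha

variable [Fintype C]

/-- The product of `kC` extends the composition of `C` (as functions, `f * g` is `g` followed by
`f`) bilinearly, undefined composites being zero; see `single_mul_single` and
`single_mul_single_of_ne`. -/
instance : Mul (CategoryAlgebra k C) where
  mul x y := fun c d => ∑ e : C, y.hom c e ≫ x.hom e d

lemma hom_mul (x y : CategoryAlgebra k C) (c d : C) :
    (x * y).hom c d = ∑ e : C, y.hom c e ≫ x.hom e d := rfl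

instance : Ring (CategoryAlgebra k C) where
  __ := (inferInstance : AddCommGroup (CategoryAlgebra k C))
  left_distrib x y z := by
    ext1 c d; simp [hom_mul, Finset.sum_add_distrib]
  right_distrib x y z := by
    ext1 c d; simp [hom_mul, Finset.sum_add_distrib]
  zero_mul x := by ext1 c d; simp [hom_mul]
  mul_zero x := by ext1 c d; simp [hom_mul]
  mul_assoc x y z := by
    ext1 c d
    simp only [hom_mul, Preadditive.sum_comp, Preadditive.comp_sum, Category.assoc]
    exact Finset.sum_comm
  one_mul x := by
    ext1 c d
    rw [hom_mul, Finset.sum_eq_single d]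
    · rw [hom_one_self, Category.comp_id]
    · intro e _ he
      rw [hom_one_of_ne he, Limits.comp_zero]
    · simp
  mul_one x := by
    ext1 c d
    rw [hom_mul, Finset.sum_eq_single c]
    · rw [hom_one_self, Category.id_comp]
    · intro e _ he
      rw [hom_one_of_ne he.symm, Limits.zero_comp]
    · simp

instance : Algebra k (CategoryAlgebra k C) :=
  Algebra.ofModule
    (fun r x y => by ext1 c d; simp [hom_mul, Finset.smul_sum])
    (fun r x y => by ext1 c d; simp [hom_mul, Finset.smul_sum])

lemma single_mul_single {c d e : C} (f : d ⟶ e) (g : c ⟶ d) (r s : k) :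
    single f r * single g s = single (g ≫ f) (r * s) := by
  ext1 a b
  rw [hom_mul, Finset.sum_eq_single d]
  · by_cases ha : a = c
    · subst ha
      by_cases hb : b = e
      · subst hb
        rw [hom_single_self, hom_single_self, hom_single_self, mul_comm r s]
        exact Free.single_comp_single k C g f s r
      · rw [hom_single_of_ne_right _ _ _ hb, hom_single_of_ne_right _ _ _ hb, Limits.comp_zero]
    · rw [hom_single_of_ne_left _ _ _ ha, hom_single_of_ne_left _ _ _ ha, Limits.zero_comp]
  · intro x _ hx
    rw [hom_single_of_ne_left _ _ _ hx, Limits.comp_zero]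
  · simp

lemma single_mul_single_of_ne {a b c d : C} (f : c ⟶ d) (g : a ⟶ b) (r s : k) (h : b ≠ c) :
    single f r * single g s = 0 := by
  ext1 x y
  rw [hom_mul, hom_zero]
  refine Finset.sum_eq_zero fun e _ => ?_
  by_cases he : e = c
  · rw [hom_single_of_ne_right g s x (he.trans_ne h.symm), Limits.zero_comp]
  · rw [hom_single_of_ne_left f r y he, Limits.comp_zero]

lemma one_eq_sum : (1 : CategoryAlgebra k C) = ∑ c : C, single (𝟙 c) 1 := by
  have key : ∀ (x : C → CategoryAlgebra k C) (a b : C),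
      (∑ c, x c).hom a b = ∑ c, (x c).hom a b := fun x a b =>
    map_sum (AddMonoidHom.mk' (fun z : CategoryAlgebra k C => z.hom a b)
      (fun y z => hom_add y z a b)) x Finset.univ
  ext1 a b
  rw [key, Finset.sum_eq_single a]
  · by_cases hb : b = a
    · subst hb
      rw [hom_one_self, hom_single_self]
      rfl
    · rw [hom_one_of_ne (Ne.symm hb), hom_single_of_ne_right _ _ _ hb]
  · intro c _ hc
    exact hom_single_of_ne_left _ _ _ hc.symm
  · simp

end CategoryAlgebra

/-! ### Simple modules of the category algebra of a skeletal EI-category -/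

/-- In a skeletal EI-category there are no morphisms `c ⟶ e ⟶ c` with `e ≠ c`. -/
lemma eq_of_hom_hom {C : Type u} [Category.{v} C] [IsEI C] (hC : Skeletal C) {c e : C}
    (f : c ⟶ e) (g : e ⟶ c) : c = e := by
  have h1 : IsIso (f ≫ g) := IsEI.isIso_endo _
  have h2 : IsIso (g ≫ f) := IsEI.isIso_endo _
  have h3 : IsSplitMono f := isSplitMono_of_comp f g inferInstance
  have h4 : IsSplitEpi f := isSplitEpi_of_comp g f inferInstance
  have h5 : IsIso f := isIso_of_epi_of_isSplitMono f
  exact hC ⟨asIso f⟩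

section Inflation

variable (k : Type w) {C : Type u} [Field k] [Category.{v} C]

lemma ofCoeff_comp (c : C) (x y : Free.of k c ⟶ Free.of k c) :
    (MonoidAlgebra.ofCoeff (y ≫ x : Free.of k c ⟶ Free.of k c) : k[End c]) =
      (MonoidAlgebra.ofCoeff x : k[End c]) * (MonoidAlgebra.ofCoeff y : k[End c]) := by
  induction x using Finsupp.induction_linear with
  | zero => exact (congrArg _ Limits.comp_zero).trans (zero_mul _).symm
  | add x₁ x₂ h₁ h₂ =>
    refine (congrArg _ (Preadditive.comp_add _ _ _ y x₁ x₂)).trans ?_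
    exact (congrArg₂ (· + ·) h₁ h₂).trans (add_mul _ _ _).symm
  | single f r =>
    induction y using Finsupp.induction_linear with
    | zero => exact (congrArg _ Limits.zero_comp).trans (mul_zero _).symm
    | add y₁ y₂ h₁ h₂ =>
      refine (congrArg _ (Preadditive.add_comp (Free.of k c) (Free.of k c) (Free.of k c)
        y₁ y₂ _)).trans ?_
      exact (congrArg₂ (· + ·) h₁ h₂).trans (mul_add _ _ _).symm
    | single g s =>
      refine (congrArg _ (Free.single_comp_single k C g f s r)).trans ?_
      rw [mul_comm s r]
      exact (MonoidAlgebra.single_mul_single (M := @End C _ c) (End.of (X := (c : C)) f)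
        (End.of (X := (c : C)) g) r s).symm

variable [Fintype C] [IsEI C]

/-- For an object `c` of a finite skeletal EI-category `C`, the homomorphism `kC → kC(c, c)` of
`k`-algebras that fixes the morphisms in `C(c, c)` and sends all other morphisms to zero. -/
def toGroupAlgebra (hC : Skeletal C) (c : C) : CategoryAlgebra k C →ₐ[k] k[End c] :=
  AlgHom.ofLinearMap
    { toFun := fun x => MonoidAlgebra.ofCoeff (x c c)
      map_add' := fun x y => rfl
      map_smul' := fun r x => rfl }
    (congrArg MonoidAlgebra.ofCoeff (CategoryAlgebra.hom_one_self c))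
    (fun x y => by
      have h : (x * y).hom c c = y.hom c c ≫ x.hom c c := by
        rw [CategoryAlgebra.hom_mul]
        refine Finset.sum_eq_single c (fun e _ he => ?_) (by simp)
        by_cases hce : Nonempty (c ⟶ e)
        · obtain ⟨f⟩ := hce
          have hx : x.hom e c = 0 := Finsupp.ext fun g => absurd (eq_of_hom_hom hC f g).symm he
          rw [hx, Limits.comp_zero]
        · have hy : y.hom c e = 0 := Finsupp.ext fun f => absurd ⟨f⟩ hce
          rw [hy, Limits.zero_comp]
      exact (congrArg MonoidAlgebra.ofCoeff h).trans (ofCoeff_comp k c _ _))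

lemma toGroupAlgebra_single (hC : Skeletal C) {c : C} (f : c ⟶ c) (r : k) :
    toGroupAlgebra k hC c (.single f r) = MonoidAlgebra.single (End.of f) r :=
  congrArg MonoidAlgebra.ofCoeff (CategoryAlgebra.hom_single_self f r)

lemma toGroupAlgebra_single_of_ne_left (hC : Skeletal C) {c a b : C} (f : a ⟶ b) (r : k)
    (h : c ≠ a) : toGroupAlgebra k hC c (.single f r) = 0 :=
  congrArg MonoidAlgebra.ofCoeff (CategoryAlgebra.hom_single_of_ne_left f r c h)

lemma toGroupAlgebra_single_of_ne_right (hC : Skeletal C) {c a b : C} (f : a ⟶ b) (r : k)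
    (h : c ≠ b) : toGroupAlgebra k hC c (.single f r) = 0 :=
  congrArg MonoidAlgebra.ofCoeff (CategoryAlgebra.hom_single_of_ne_right f r c h)

lemma toGroupAlgebra_surjective (hC : Skeletal C) (c : C) :
    Function.Surjective (toGroupAlgebra k hC c) := fun x => by
  classical
  refine ⟨fun a b => if h : c = a ∧ c = b then
    Finsupp.mapDomain (fun f : c ⟶ c => eqToHom h.1.symm ≫ f ≫ eqToHom h.2) x.coeff else 0, ?_⟩
  refine congrArg MonoidAlgebra.ofCoeff (?_ : _ = x.coeff)
  simp only [and_self, dif_pos, eqToHom_refl, Category.id_comp, Category.comp_id]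
  exact Finsupp.mapDomain_id

/-- A `kC(c, c)`-module `U`, viewed as a `kC`-module with the same underlying space: the morphisms
in `C(c, c)` act as they do on `U`, all other morphisms act as zero. -/
def inflation (hC : Skeletal C) (c : C) :
    ModuleCat.{t} k[End c] ⥤ ModuleCat.{t} (CategoryAlgebra k C) :=
  ModuleCat.restrictScalars (toGroupAlgebra k hC c).toRingHom

lemma isSimpleModule_inflation (hC : Skeletal C) (c : C) (U : ModuleCat.{t} k[End c])
    (hU : IsSimpleModule k[End c] U) :
    IsSimpleModule (CategoryAlgebra k C) ((inflation k hC c).obj U) := by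
  let f := (toGroupAlgebra k hC c).toRingHom
  have : RingHomSurjective f := ⟨toGroupAlgebra_surjective k hC c⟩
  let l : (inflation k hC c).obj U →ₛₗ[f] U :=
    { toFun := fun x => x
      map_add' := fun _ _ => rfl
      map_smul' := fun _ _ => rfl }
  exact (l.isSimpleModule_iff_of_bijective Function.bijective_id).mpr hU

/-- The map `∐_c Irr(C(c, c)) → Irr(kC)` that sends the class of `U` to the class of the `kC`-module
on which the morphisms in `C(c, c)` act as they do on `U`, and all other morphisms act as zero. -/
def vertexMap (hC : Skeletal C) (p : Σ c : C, Irr.{t} k[End c]) : Irr.{t} (CategoryAlgebra k C) :=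
  Quotient.map
    (fun U : SimpleMod.{t} k[End p.1] =>
      (⟨(inflation k hC p.1).obj U.1, isSimpleModule_inflation k hC p.1 U.1 U.2⟩ :
        SimpleMod.{t} (CategoryAlgebra k C)))
    (fun U V (he : Nonempty (U.1 ≅ V.1)) => he.map (inflation k hC p.1).mapIso)
    p.2

end Inflation

end
end EIQuiver

/-! Write A for the category algebra, B for the product of the group algebras kC(c,c), σ : B → A for
the inclusion (`ofGroupAlgebras`) and π : A → B for the projection killing every non-endomorphism
(`toGroupAlgebras`). Since C is skeletal and EI, π is an algebra homomorphism with πσ = 1. A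
morphism between distinct objects strictly raises a bounded height, so every element of ker π is
nilpotent, while B is semisimple by Maschke. Hence rad A = ker π (`jacobson_categoryAlgebra`) and A
/ rad A ≅ B, which gives both the splitting and the list of simple modules.

For the arrows, `Ext¹` is computed relative to σ. Every A-module T embeds in the coinduced module
Hom_B(A,T), which is injective because B is semisimple. The long exact sequence presents Ext¹(S,T)
as the cokernel of Hom(S, Hom_B(A,T)) → Hom(S, Hom_B(A,T)/T). The target is the space of derivations
A → Hom_k(S,T) vanishing on B (`relDerToHom_bijective`). If S and T are killed by rad A, the map is
zero, so Ext¹ is this whole space (`relDerToExt_bijective`).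

For S = U at c and T = V at c', the Leibniz rule makes such a derivation vanish on every morphism
that is not an irreducible morphism c → c'. On those it is an equivariant map k[Irr(c,c')] →
Hom_k(U,V), and every equivariant map arises (`relDerToIntertwining_bijective`). Finally Hom_k(U,V)
≅ V ⊗ U* has only scalar endomorphisms over a splitting field, so the dimension of the space of
equivariant maps is the multiplicity of V ⊗ U* (`multiplicity_tensorDual`). -/

namespace EIQuiver

open CategoryTheory
open scoped MonoidAlgebra

noncomputable section

/-! ### Relative derivations and `Ext¹` -/

section RelativeDerivations

variable (k : Type w) {A : Type t} {B : Type t} [Field k] [Ring A] [Algebra k A] [Ring B]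
  [Algebra k B] (σ : B →ₐ[k] A)
  (M N : Type*) [AddCommGroup M] [Module k M] [Module A M] [IsScalarTower k A M]
  [AddCommGroup N] [Module k N] [Module A N] [IsScalarTower k A N]

/-- The derivations `A → Hom_k(M, N)` that vanish on the image of `σ : B → A`. -/
def relDer : Submodule k (A →ₗ[k] M →ₗ[k] N) where
  carrier := {D | (∀ a b u, D (a * b) u = a • D b u + D a (b • u)) ∧ ∀ b, D (σ b) = 0}
  add_mem' := by
    rintro D E ⟨hD, hD'⟩ ⟨hE, hE'⟩
    refine ⟨fun a b u => ?_, fun b => by simp [hD', hE']⟩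
    simp only [LinearMap.add_apply, hD, hE, smul_add]
    abel
  zero_mem' := by simp
  smul_mem' := by
    rintro r D ⟨hD, hD'⟩
    refine ⟨fun a b u => ?_, fun b => by simp [hD']⟩
    simp only [LinearMap.smul_apply, hD, smul_add, smul_comm r a]

end RelativeDerivations

section ExtRelDer

variable (k : Type w) {A : Type t} {B : Type t} [Field k] [Ring A] [Algebra k A] [Ring B]
  [Algebra k B] (σ : B →ₐ[k] A) (S T : ModuleCat.{t} A)

/-- The coinduced module `Hom_B(A, T)`. -/
abbrev coind : ModuleCat.{t} A :=
  (ModuleCat.coextendScalars σ.toRingHom).obj ((ModuleCat.restrictScalars σ.toRingHom).obj T)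

/-- Over the semisimple ring B every module is injective, and coinduction preserves injectives
because it is right adjoint to restriction, which preserves monomorphisms. -/
instance coind_injective [IsSemisimpleRing B] : Injective (coind k σ T) := by
  let T' : ModuleCat.{t} B := (ModuleCat.restrictScalars σ.toRingHom).obj T
  have : Module.Injective B T' := Module.injective_of_isSemisimpleRing _ _
  have : Injective T' := Module.injective_object_of_injective_module B T'
  exact Injective.injective_of_adjoint (ModuleCat.restrictCoextendScalarsAdj σ.toRingHom) _

/-- The value at `a` of an element of the coinduced module. -/
def coindEval (a : A) : coind k σ T →+ T where
  toFun g := ModuleCat.CoextendScalars.equiv _ _ g a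
  map_zero' := rfl
  map_add' _ _ := rfl

lemma coindEval_smul (a b : A) (g : coind k σ T) :
    coindEval k σ T a (b • g) = coindEval k σ T (a * b) g := rfl

lemma coindEval_add (a b : A) (g : coind k σ T) :
    coindEval k σ T (a + b) g = coindEval k σ T a g + coindEval k σ T b g :=
  LinearMap.map_add (ModuleCat.CoextendScalars.equiv _ _ g) a b

lemma coindEval_mul (b : B) (a : A) (g : coind k σ T) :
    coindEval k σ T (σ b * a) g = σ b • coindEval k σ T a g :=
  LinearMap.map_smul (ModuleCat.CoextendScalars.equiv _ _ g) b a

variable {k σ T} in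
lemma coind_ext {g h : coind k σ T} (H : ∀ a, coindEval k σ T a g = coindEval k σ T a h) :
    g = h :=
  ModuleCat.CoextendScalars.ext (LinearMap.ext H)

/-- An element of the coinduced module. -/
def coindMk (φ : A →+ T) (h : ∀ (b : B) (a : A), φ (σ b * a) = σ b • φ a) : coind k σ T :=
  (ModuleCat.CoextendScalars.equiv _ _).symm
    { toFun := φ
      map_add' := fun x y => φ.map_add x y
      map_smul' := fun b a => h b a }

/-- The unit `T → Hom_B(A, T)`. -/
def coindUnit : T →ₗ[A] coind k σ T where
  toFun v := coindMk k σ T (AddMonoidHom.mk' (fun a : A => a • v) fun a b => add_smul a b v)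
    fun b a => mul_smul (σ b) a v
  map_add' v w := coind_ext fun a => smul_add a v w
  map_smul' b v := coind_ext fun a => (mul_smul a b v).symm

lemma coindEval_coindUnit (a : A) (v : T) : coindEval k σ T a (coindUnit k σ T v) = a • v := rfl

lemma coindUnit_injective : Function.Injective (coindUnit k σ T) := fun v w h => by
  simpa only [coindEval_coindUnit, one_smul] using congrArg (coindEval k σ T 1) h

/-- The short complex `T → Hom_B(A, T) → Hom_B(A, T) / T`. -/
def coindComplex : ShortComplex (ModuleCat.{t} A) where
  X₁ := T
  X₂ := coind k σ T
  X₃ := ModuleCat.of A (coind k σ T ⧸ (coindUnit k σ T).range)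
  f := ModuleCat.ofHom (coindUnit k σ T)
  g := ModuleCat.ofHom (coindUnit k σ T).range.mkQ
  zero := by
    ext v
    exact (Submodule.Quotient.mk_eq_zero _).mpr ⟨v, rfl⟩

lemma coindComplex_shortExact : (coindComplex k σ T).ShortExact :=
  ModuleCat.shortComplex_shortExact _
    (LinearMap.exact_iff.mpr (Submodule.ker_mkQ _))
    (coindUnit_injective k σ T) (Submodule.mkQ_surjective _)

/-- The map `g ↦ g a - a • g 1` on the quotient `Hom_B(A, T) / T`. -/
def coindQuotEval (a : A) : (coind k σ T ⧸ (coindUnit k σ T).range) →+ T :=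
  QuotientAddGroup.lift (coindUnit k σ T).range.toAddSubgroup
    (coindEval k σ T a - (DistribSMul.toAddMonoidHom T a).comp (coindEval k σ T 1))
    (by
      rintro _ ⟨v, rfl⟩
      simp [coindEval_coindUnit])

lemma coindQuotEval_mk (a : A) (g : coind k σ T) :
    coindQuotEval k σ T a (Submodule.Quotient.mk g) =
      coindEval k σ T a g - a • coindEval k σ T 1 g := rfl

lemma coindQuotEval_add (a b : A) (q : coind k σ T ⧸ (coindUnit k σ T).range) :
    coindQuotEval k σ T (a + b) q = coindQuotEval k σ T a q + coindQuotEval k σ T b q := by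
  obtain ⟨g, rfl⟩ := Submodule.Quotient.mk_surjective _ q
  simp only [coindQuotEval_mk, coindEval_add, add_smul]
  abel

/-- The Leibniz rule: with `coindQuotEval_map`, it makes every homomorphism from S to the quotient a
derivation vanishing on B. -/
lemma coindQuotEval_mul (b a : A) (q : coind k σ T ⧸ (coindUnit k σ T).range) :
    coindQuotEval k σ T (b * a) q = b • coindQuotEval k σ T a q + coindQuotEval k σ T b (a • q) := by
  obtain ⟨g, rfl⟩ := Submodule.Quotient.mk_surjective _ q
  rw [← Submodule.Quotient.mk_smul]
  simp only [coindQuotEval_mk, coindEval_smul, one_mul, smul_sub, mul_smul]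
  abel

lemma coindQuotEval_map (b : B) (q : coind k σ T ⧸ (coindUnit k σ T).range) :
    coindQuotEval k σ T (σ b) q = 0 := by
  obtain ⟨g, rfl⟩ := Submodule.Quotient.mk_surjective _ q
  rw [coindQuotEval_mk, ← coindEval_mul, mul_one, sub_self]

variable {k σ T} in
-- If g a = a • g 1 for all a, then g is the image of g 1 under the unit, hence zero in the
-- quotient.
lemma coindQuot_ext {p q : coind k σ T ⧸ (coindUnit k σ T).range}
    (h : ∀ a, coindQuotEval k σ T a p = coindQuotEval k σ T a q) : p = q := by
  rw [← sub_eq_zero]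
  replace h : ∀ a, coindQuotEval k σ T a (p - q) = 0 := fun a => by
    rw [map_sub, h, sub_self]
  generalize p - q = q at h ⊢
  obtain ⟨g, rfl⟩ := Submodule.Quotient.mk_surjective _ q
  refine (Submodule.Quotient.mk_eq_zero _).mpr ⟨coindEval k σ T 1 g, coind_ext fun a => ?_⟩
  rw [coindEval_coindUnit]
  exact (sub_eq_zero.mp (h a)).symm

open scoped ModuleCat

variable {k σ S T} in
/-- The homomorphism `S → Hom_B(A, T) / T` given by a derivation. -/
def relDerHom (D : relDer k σ S T) : S →ₗ[A] (coind k σ T ⧸ (coindUnit k σ T).range) where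
  toFun u := Submodule.Quotient.mk (coindMk k σ T
    (AddMonoidHom.mk' (fun a : A => D.1 a u) fun a b => by rw [map_add, LinearMap.add_apply])
    -- B-linearity in a: the other Leibniz term contains D (σ b) = 0.
    fun b a => by
      have h := D.2.1 (σ b) a u
      rw [D.2.2 b, LinearMap.zero_apply, add_zero] at h
      exact h)
  map_add' u v := by
    rw [← Submodule.Quotient.mk_add]
    exact congrArg _ (coind_ext fun a => map_add (D.1 a) u v)
  map_smul' b u := by
    rw [RingHom.id_apply, ← Submodule.Quotient.mk_smul]
    symm
    rw [Submodule.Quotient.eq]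
    -- u ↦ (a ↦ D a u) is A-linear only modulo T: by Leibniz the defect D (a * b) u - D a (b • u) is
    -- a • D b u, the unit at D b u.
    refine ⟨D.1 b u, coind_ext fun a => ?_⟩
    rw [map_sub, coindEval_smul]
    change a • D.1 b u = D.1 (a * b) u - D.1 a (b • u)
    rw [D.2.1 a b u, add_sub_cancel_right]

lemma coindQuotEval_relDerHom (D : relDer k σ S T) (a : A) (u : S) :
    coindQuotEval k σ T a (relDerHom D u) = D.1 a u := by
  have h := D.2.2 1
  rw [map_one] at h
  change D.1 a u - a • D.1 1 u = _
  rw [h, LinearMap.zero_apply, smul_zero, sub_zero]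

lemma coindQuotEval_algebraMap_mul (r : k) (a : A)
    (q : coind k σ T ⧸ (coindUnit k σ T).range) :
    coindQuotEval k σ T (algebraMap k A r * a) q = r • coindQuotEval k σ T a q := by
  rw [coindQuotEval_mul, ← σ.commutes r, coindQuotEval_map, add_zero, σ.commutes, algebraMap_smul]

lemma coindQuotEval_algebraMap_smul (r : k) (a : A)
    (q : coind k σ T ⧸ (coindUnit k σ T).range) :
    coindQuotEval k σ T a (algebraMap k A r • q) = r • coindQuotEval k σ T a q := by
  rw [← coindQuotEval_algebraMap_mul, Algebra.commutes r a, coindQuotEval_mul, ← σ.commutes r,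
    coindQuotEval_map, smul_zero, zero_add]

/-- The map from derivations to homomorphisms `S → Hom_B(A, T) / T`. -/
def relDerToHom : relDer k σ S T →ₗ[k] (S ⟶ (coindComplex k σ T).X₃) where
  toFun D := ModuleCat.ofHom (relDerHom D)
  map_add' D E := by
    refine ModuleCat.hom_ext (LinearMap.ext fun u => coindQuot_ext fun a => ?_)
    refine Eq.trans ?_ (map_add (coindQuotEval k σ T a) (relDerHom D u) (relDerHom E u)).symm
    rw [coindQuotEval_relDerHom, coindQuotEval_relDerHom]
    exact coindQuotEval_relDerHom ..
  map_smul' r D := by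
    refine ModuleCat.hom_ext (LinearMap.ext fun u => coindQuot_ext fun a => ?_)
    refine Eq.trans ?_ (coindQuotEval_algebraMap_smul k σ T r a (relDerHom D u)).symm
    rw [coindQuotEval_relDerHom]
    exact coindQuotEval_relDerHom ..

lemma coindQuotEval_relDerToHom (D : relDer k σ S T) (a : A) (u : S) :
    coindQuotEval k σ T a ((relDerToHom k σ S T D).hom u) = D.1 a u :=
  coindQuotEval_relDerHom ..

lemma relDerToHom_bijective : Function.Bijective (relDerToHom k σ S T) := by
  constructor
  · refine (injective_iff_map_eq_zero _).mpr fun D hD => Subtype.ext (LinearMap.ext fun a =>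
      LinearMap.ext fun u => ?_)
    rw [← coindQuotEval_relDerToHom, hD]
    exact map_zero _
  · intro h
    let h' : S →ₗ[A] (coind k σ T ⧸ (coindUnit k σ T).range) := h.hom
    refine ⟨⟨LinearMap.mk₂ k (fun a u => coindQuotEval k σ T a (h' u))
      (fun a b u => coindQuotEval_add ..)
      (fun r a u => by rw [Algebra.smul_def, coindQuotEval_algebraMap_mul])
      (fun a u v => by rw [map_add, map_add])
      (fun r a u => by rw [← algebraMap_smul A r u, map_smul,
        coindQuotEval_algebraMap_smul]), ?_, ?_⟩, ?_⟩
    · intro a b u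
      simp only [LinearMap.mk₂_apply, coindQuotEval_mul, map_smul]
    · intro b
      ext u
      simp only [LinearMap.mk₂_apply, coindQuotEval_map, LinearMap.zero_apply]
    · exact ModuleCat.hom_ext (LinearMap.ext fun u => coindQuot_ext fun a =>
        coindQuotEval_relDerToHom ..)

/-- The connecting homomorphism from derivations to `Ext¹`. -/
def relDerToExt : relDer k σ S T →ₗ[k] Abelian.Ext S T 1 :=
  ((coindComplex_shortExact k σ T).extClass.postcompOfLinear k S (zero_add 1)).comp
    ((Abelian.Ext.linearEquiv₀ (R := k)).symm.toLinearMap.comp (relDerToHom k σ S T))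

variable {k σ S T} in
-- If b acts as a does on S and on T, a lift g satisfies g(u)(a) = g(a • u)(1) = g(σ b • u)(1) =
-- g(u)(σ b) = σ b • g(u)(1) = a • g(u)(1), so the derivation it induces is zero.
lemma relDerToHom_eq_zero_of_lift
    (h : ∀ a : A, ∃ b : B, (∀ u : S, a • u = σ b • u) ∧ ∀ v : T, a • v = σ b • v)
    (D : relDer k σ S T) (g : S ⟶ coind k σ T)
    (hg : g ≫ (coindComplex k σ T).g = relDerToHom k σ S T D) : D = 0 := by
  refine Subtype.ext (LinearMap.ext fun a => LinearMap.ext fun u => ?_)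
  rw [← coindQuotEval_relDerToHom, ← hg]
  change coindEval k σ T a (g.hom u) - a • coindEval k σ T 1 (g.hom u) = 0
  obtain ⟨b, hb, hb'⟩ := h a
  rw [← one_mul a, ← coindEval_smul, one_mul, ← map_smul, hb, hb', map_smul, coindEval_smul,
    one_mul, ← coindEval_mul, mul_one, sub_self]

lemma relDerToExt_apply (D : relDer k σ S T) : relDerToExt k σ S T D =
    (Abelian.Ext.mk₀ (relDerToHom k σ S T D)).comp (coindComplex_shortExact k σ T).extClass
      (zero_add 1) := rfl

variable {k σ S T} in
-- Exactness at Hom(S, Hom_B(A,T)/T) and the vanishing of liftable derivations give injectivity.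
-- Surjectivity holds because `Ext¹` into the injective coinduced module is zero.
theorem relDerToExt_bijective [IsSemisimpleRing B]
    (h : ∀ a : A, ∃ b : B, (∀ u : S, a • u = σ b • u) ∧ ∀ v : T, a • v = σ b • v) :
    Function.Bijective (relDerToExt k σ S T) := by
  constructor
  · refine (injective_iff_map_eq_zero _).mpr fun D hD => ?_
    rw [relDerToExt_apply] at hD
    obtain ⟨x, hx⟩ := Abelian.Ext.covariant_sequence_exact₃ _ _ _ _ hD
    obtain ⟨g, rfl⟩ := (Abelian.Ext.mk₀_bijective _ _).2 x
    rw [Abelian.Ext.mk₀_comp_mk₀] at hx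
    exact relDerToHom_eq_zero_of_lift h D g ((Abelian.Ext.mk₀_bijective _ _).1 hx)
  · intro x
    have : Injective (coindComplex k σ T).X₂ := coind_injective k σ T
    obtain ⟨y, hy⟩ := Abelian.Ext.covariant_sequence_exact₁ S (coindComplex_shortExact k σ T) x
      (Abelian.Ext.eq_zero_of_injective _) (zero_add 1)
    obtain ⟨g, rfl⟩ := (Abelian.Ext.mk₀_bijective _ _).2 y
    obtain ⟨D, rfl⟩ := (relDerToHom_bijective k σ S T).2 g
    exact ⟨D, hy⟩

end ExtRelDer

/-! ### Multiplicity as the dimension of a Hom space -/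

section Multiplicity

variable {k R W T : Type*} [Field k] [Ring R] [Algebra k R]
  [AddCommGroup W] [Module R W]
  [AddCommGroup T] [Module R T] [Module k T] [IsScalarTower k R T]

/-- The projection onto a direct summand is a scalar, so the summand is zero or everything. -/
lemma isSimpleModule_of_scalar_end [Nontrivial T] [IsSemisimpleModule R T]
    (hT : ∀ φ : T →ₗ[R] T, ∃ c : k, ∀ x, φ x = c • x) : IsSimpleModule R T := by
  rw [isSimpleModule_iff]
  refine { eq_bot_or_eq_top := fun N => ?_ }
  obtain ⟨N', h⟩ := exists_isCompl N
  obtain ⟨c, hc⟩ := hT (N.projection N' h)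
  by_cases hc0 : c = 0
  · left
    rw [eq_bot_iff]
    intro x hx
    have := hc x
    rw [Submodule.projection_apply_left h ⟨x, hx⟩, hc0, zero_smul] at this
    exact this
  · right
    rw [eq_top_iff]
    intro x _
    have hx : c • x ∈ N := hc x ▸ Submodule.projection_apply_mem h x
    have := N.smul_mem (algebraMap k R c⁻¹) hx
    rwa [algebraMap_smul, inv_smul_smul₀ hc0] at this

lemma finrank_end_eq_one [Nontrivial T]
    (hT : ∀ φ : T →ₗ[R] T, ∃ c : k, ∀ x, φ x = c • x) : Module.finrank k (T →ₗ[R] T) = 1 := by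
  refine finrank_eq_one LinearMap.id ?_ fun φ => ?_
  · intro h
    obtain ⟨x, hx⟩ := exists_ne (0 : T)
    exact hx (LinearMap.congr_fun h x)
  · obtain ⟨c, hc⟩ := hT φ
    exact ⟨c, LinearMap.ext fun x => (hc x).symm⟩

variable (W) in
-- A nonzero map W → T is onto and splits, and the image of the splitting is a copy of T inside the
-- isotypic component, so the map does not vanish there. Extension of maps is semisimplicity of W.
lemma restrict_isotypicComponent_bijective [IsSemisimpleModule R W] [IsSimpleModule R T] :
    Function.Bijective fun f : W →ₗ[R] T => f.comp (isotypicComponent R W T).subtype := by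
  constructor
  · intro f g hfg
    rw [← sub_eq_zero]
    set p := f - g with hp
    have hp0 : ∀ x ∈ isotypicComponent R W T, p x = 0 := fun x hx => by
      rw [hp, LinearMap.sub_apply, sub_eq_zero]
      exact LinearMap.congr_fun hfg ⟨x, hx⟩
    by_contra hne
    have hs : Function.Surjective p := (LinearMap.surjective_or_eq_zero p).resolve_right hne
    obtain ⟨s, hs⟩ := IsSemisimpleModule.lifting_property p hs LinearMap.id
    have hinj : Function.Injective s := fun x y hxy => by
      rw [← LinearMap.id_apply (R := R) x, ← hs, LinearMap.comp_apply, hxy, ← LinearMap.comp_apply,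
        hs, LinearMap.id_apply]
    have hle : LinearMap.range s ≤ isotypicComponent R W T :=
      le_sSup ⟨(LinearEquiv.ofInjective s hinj).symm⟩
    have : Nontrivial T := IsSimpleModule.nontrivial R T
    obtain ⟨x, hx⟩ := exists_ne (0 : T)
    exact hx ((LinearMap.congr_fun hs x).symm.trans (hp0 _ (hle ⟨x, rfl⟩)))
  · intro f
    exact IsSemisimpleModule.extension_property _ (Submodule.subtype_injective _) f

/-- The isotypic component is Tⁿ, so both sides equal n: its length on one side, the dimension of
Hom(Tⁿ, T) with End(T) = k on the other. -/
theorem multiplicity_eq_finrank [IsSemisimpleRing R] [Module.Finite R W] [IsSimpleModule R T]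
    (hT : ∀ φ : T →ₗ[R] T, ∃ c : k, ∀ x, φ x = c • x) :
    multiplicity R W T = Cardinal.toENat (Module.rank k (W →ₗ[R] T)) := by
  have : Nontrivial T := IsSimpleModule.nontrivial R T
  obtain ⟨n, ⟨e⟩⟩ := (IsIsotypicOfType.isotypicComponent R W T).linearEquiv_fun
  let e₁ : (W →ₗ[R] T) ≃ₗ[k] (isotypicComponent R W T →ₗ[R] T) :=
    LinearEquiv.ofBijective
      { toFun := fun f => f.comp (isotypicComponent R W T).subtype
        map_add' := fun _ _ => rfl
        map_smul' := fun _ _ => rfl } (restrict_isotypicComponent_bijective W)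
  let e₂ : (isotypicComponent R W T →ₗ[R] T) ≃ₗ[k] ((Fin n → T) →ₗ[R] T) :=
    { toFun := fun f => f.comp e.symm.toLinearMap
      invFun := fun f => f.comp e.toLinearMap
      map_add' := fun _ _ => rfl
      map_smul' := fun _ _ => rfl
      left_inv := fun f => by ext; simp
      right_inv := fun f => by ext; simp }
  let e₃ := e₁.trans (e₂.trans (LinearMap.lsum R (fun _ : Fin n => T) k).symm)
  have h1 := finrank_end_eq_one hT
  have : Module.Finite k (T →ₗ[R] T) := Module.finite_of_finrank_eq_succ h1
  have : Module.Finite k (W →ₗ[R] T) := Module.Finite.equiv e₃.symm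
  rw [multiplicity, e.length_eq, Module.length_pi, ← Module.finrank_eq_rank, e₃.finrank_eq,
    Module.finrank_pi_fintype, Module.length_eq_one]
  simp [h1]

end Multiplicity

/-! ### Schur's lemma over a split semisimple algebra -/

section Split

variable {k : Type u} {R : Type v} [Field k] [Ring R] [Algebra k R]

/-- The diagonal matrix units are idempotents p with sum 1 and pRp = kp. Choose p and x with p • x ≠
0. Then φ(p • x) = a • p • x for some a, and applying p gives φ(p • x) = (pap) • x, a scalar
multiple of p • x. As p • x generates U, φ is that scalar. -/
theorem IsSplit.exists_eq_smul (h : IsSplit k R) (hR : Ring.jacobson R = ⊥)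
    {U : Type*} [AddCommGroup U] [Module R U] [Module k U] [IsScalarTower k R U]
    [IsSimpleModule R U] (φ : U →ₗ[R] U) : ∃ c : k, ∀ x, φ x = c • x := by
  classical
  obtain ⟨n, d, ⟨e'⟩⟩ := h
  let e : R ≃ₐ[k] ((i : Fin n) → Matrix (Fin (d i)) (Fin (d i)) k) :=
    (AlgEquiv.ofBijective (Ideal.Quotient.mkₐ k (Ring.jacobson R))
      ⟨(RingHom.injective_iff_ker_eq_bot _).mpr (by rw [← hR]; exact Ideal.mk_ker),
        Ideal.Quotient.mkₐ_surjective k _⟩).trans e'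
  let p : (i : Fin n) → Fin (d i) → R := fun i j => e.symm (Pi.single i (Matrix.single j j 1))
  have hp1 : ∑ i, ∑ j, p i j = 1 := by
    apply e.injective
    simp only [p, map_sum, AlgEquiv.apply_symm_apply, map_one]
    funext i
    rw [Finset.sum_apply, Finset.sum_eq_single i]
    · simp only [Finset.sum_apply, Pi.single_eq_same, Pi.one_apply]
      exact Matrix.sum_single_one
    · intro l _ hl
      rw [Finset.sum_apply]
      exact Finset.sum_eq_zero fun j _ => Pi.single_eq_of_ne hl.symm _
    · simp
  have hp2 : ∀ i j a, ∃ c : k, p i j * a * p i j = c • p i j := by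
    intro i j a
    refine ⟨(e a i : Matrix (Fin (d i)) (Fin (d i)) k) j j, e.injective ?_⟩
    simp only [p, map_mul, map_smul, AlgEquiv.apply_symm_apply]
    funext l
    by_cases hl : l = i
    · subst hl
      simp only [Pi.mul_apply, Pi.single_eq_same, Pi.smul_apply]
      rw [Matrix.single_mul_mul_single, one_mul, mul_one, Matrix.smul_single, smul_eq_mul, mul_one]
    · simp only [Pi.mul_apply, Pi.single_eq_of_ne hl, Pi.smul_apply, zero_mul, smul_zero]
  have hpp : ∀ i j, p i j * p i j = p i j := by
    intro i j
    apply e.injective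
    simp only [p, map_mul, AlgEquiv.apply_symm_apply]
    rw [← Pi.single_mul]
    simp
  have : Nontrivial U := IsSimpleModule.nontrivial R U
  obtain ⟨x, hx⟩ := exists_ne (0 : U)
  obtain ⟨i, j, hij⟩ : ∃ i j, p i j • x ≠ 0 := by
    by_contra! hcon
    apply hx
    rw [← one_smul R x, ← hp1, Finset.sum_smul]
    refine Finset.sum_eq_zero fun i _ => ?_
    rw [Finset.sum_smul]
    exact Finset.sum_eq_zero fun j _ => hcon i j
  have hgen : ∀ y, ∃ a : R, a • p i j • x = y := IsSimpleModule.toSpanSingleton_surjective R hij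
  obtain ⟨a, ha⟩ := hgen (φ (p i j • x))
  obtain ⟨c, hc⟩ := hp2 i j a
  refine ⟨c, fun y => ?_⟩
  obtain ⟨b, rfl⟩ := hgen y
  have key : φ (p i j • x) = c • p i j • x := by
    conv_lhs => rw [← hpp, mul_smul, map_smul, ← ha, smul_smul, smul_smul]
    rw [hc, smul_assoc]
  rw [map_smul, key, smul_comm]

end Split

/-! ### The simple module V ⊗ U* for a product of two groups -/

section TensorDual

variable {k H G U V : Type*} [Field k] [Group H] [Group G]
  [AddCommGroup U] [Module k U] [AddCommGroup V] [Module k V]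

/-- For f in U* and u in U, the map v ↦ ψ(f ⊗ v)(u) commutes with H, so it is a scalar β(f,u). The
form β is bilinear, hence an endomorphism of U ≅ U**. It commutes with G, so β(f,u) = c f(u). Thus ψ
= c on rank-one maps, which span Hom(U,V). -/
theorem linHom_commutant [Nontrivial V] [FiniteDimensional k U] (ρ : Representation k G U)
    (τ : Representation k H V)
    (hρ : ∀ φ : U →ₗ[k] U, (∀ g x, φ (ρ g x) = ρ g (φ x)) → ∃ c : k, ∀ x, φ x = c • x)
    (hτ : ∀ φ : V →ₗ[k] V, (∀ g x, φ (τ g x) = τ g (φ x)) → ∃ c : k, ∀ x, φ x = c • x)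
    (ψ : (U →ₗ[k] V) →ₗ[k] (U →ₗ[k] V))
    (hψ : ∀ h g x, ψ (τ h ∘ₗ x ∘ₗ ρ g) = τ h ∘ₗ ψ x ∘ₗ ρ g) : ∃ c : k, ∀ x, ψ x = c • x := by
  obtain ⟨v₀, hv₀⟩ := exists_ne (0 : V)
  have h1 : ∀ (f : Module.Dual k U) (u : U), ∃ c : k, ∀ v, ψ (f.smulRight v) u = c • v := by
    intro f u
    refine hτ ((LinearMap.applyₗ u).comp (ψ.comp (LinearMap.smulRightₗ f))) fun h v => ?_
    have := hψ h 1 (f.smulRight v)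
    rw [map_one] at this
    have h2 : τ h ∘ₗ f.smulRight v ∘ₗ 1 = f.smulRight (τ h v) := by
      ext; simp
    rw [h2] at this
    simpa using LinearMap.congr_fun this u
  choose β hβ using h1
  have huniq : ∀ {c d : k}, c • v₀ = d • v₀ → c = d := fun h => smul_left_injective k hv₀ h
  let B : U →ₗ[k] Module.Dual k (Module.Dual k U) :=
    LinearMap.mk₂ k (fun u f => β f u)
      (fun u u' f => huniq (by rw [← hβ, add_smul, ← hβ, ← hβ, map_add]))
      (fun c u f => huniq (by rw [← hβ, smul_assoc, ← hβ, map_smul]))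
      (fun u f f' => huniq (by
        rw [← hβ, add_smul, ← hβ, ← hβ, ← LinearMap.add_apply, ← map_add]
        congr 2; ext; simp [add_smul]))
      (fun c u f => huniq (by
        rw [← hβ, smul_assoc, ← hβ, ← LinearMap.smul_apply, ← map_smul]
        congr 2; ext; simp [mul_smul]))
  obtain ⟨c, hc⟩ := hρ ((Module.evalEquiv k U).symm.toLinearMap.comp B) fun g u => by
    apply (Module.evalEquiv k U).injective
    ext f
    simp only [LinearMap.comp_apply, LinearEquiv.coe_coe, LinearEquiv.apply_symm_apply]
    have h3 : f (ρ g ((Module.evalEquiv k U).symm (B u))) = B u (f ∘ₗ ρ g) := by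
      conv_rhs => rw [← (Module.evalEquiv k U).apply_symm_apply (B u)]
      rfl
    refine Eq.trans ?_ h3.symm
    refine huniq ?_
    change β f (ρ g u) • v₀ = β (f ∘ₗ ρ g) u • v₀
    rw [← hβ, ← hβ]
    have := hψ 1 g (f.smulRight v₀)
    rw [map_one] at this
    have h2 : 1 ∘ₗ f.smulRight v₀ ∘ₗ ρ g = (f ∘ₗ ρ g).smulRight v₀ := by
      ext; simp
    rw [h2] at this
    rw [this]
    rfl
  have h4 : ∀ f u, β f u = c * f u := fun f u => by
    have : B u = Module.evalEquiv k U (c • u) := by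
      rw [← hc u]; simp
    have := LinearMap.congr_fun this f
    simpa [B] using this
  refine ⟨c, fun x => ?_⟩
  obtain ⟨y, rfl⟩ := (dualTensorHomEquiv k U V).surjective x
  induction y using TensorProduct.induction_on with
  | zero => simp
  | add y z hy hz => rw [map_add, map_add, hy, hz, smul_add]
  | tmul f v =>
    ext u
    have h5 : dualTensorHomEquiv k U V (TensorProduct.tmul k f v) = f.smulRight v := by
      ext; simp
    rw [h5, hβ, h4, mul_smul]
    rfl

/-- The isomorphism `V ⊗ U* ≃ Hom_k(U, V)` of representations of `H × G`. -/
def tprodDualEquivLinHom [FiniteDimensional k U] [FiniteDimensional k V]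
    (ρ : Representation k G U) (τ : Representation k H V) :
    (Representation.tprod (τ.comp (MonoidHom.fst H G)) (ρ.dual.comp (MonoidHom.snd H G))).Equiv
      (Representation.linHom (ρ.comp (MonoidHom.snd H G)) (τ.comp (MonoidHom.fst H G))) :=
  (Representation.TensorProduct.comm (τ.comp (MonoidHom.fst H G))
      (ρ.dual.comp (MonoidHom.snd H G))).trans
    (Representation.Equiv.dualTensorHom (ρ.comp (MonoidHom.snd H G)) (τ.comp (MonoidHom.fst H G)))

lemma linHom_end_scalar [Nontrivial V] [FiniteDimensional k U] (ρ : Representation k G U)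
    (τ : Representation k H V)
    (hρ : ∀ φ : U →ₗ[k] U, (∀ g x, φ (ρ g x) = ρ g (φ x)) → ∃ c : k, ∀ x, φ x = c • x)
    (hτ : ∀ φ : V →ₗ[k] V, (∀ g x, φ (τ g x) = τ g (φ x)) → ∃ c : k, ∀ x, φ x = c • x)
    (φ : (Representation.linHom (ρ.comp (MonoidHom.snd H G))
        (τ.comp (MonoidHom.fst H G))).IntertwiningMap
      (Representation.linHom (ρ.comp (MonoidHom.snd H G)) (τ.comp (MonoidHom.fst H G)))) :
    ∃ c : k, ∀ x, φ x = c • x :=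
  linHom_commutant ρ τ hρ hτ φ.toLinearMap fun h g x => by
    -- `Representation.linHom` precomposes with the inverse, hence g⁻¹ here.
    simpa using LinearMap.congr_fun (φ.isIntertwining' (h, g⁻¹)) x

end TensorDual

section SplittingField

open scoped ModuleCat

variable {k : Type w} {G : Type u} {H : Type v} [Field k] [Group G] [Group H]

lemma single_smul_eq (U : ModuleCat.{t} k[G]) (g : G) (r : k) (x : U) :
    (MonoidAlgebra.single g r : k[G]) • x = r • MonoidAlgebra.of k G g • x := by
  rw [← smul_assoc, MonoidAlgebra.of_apply, MonoidAlgebra.smul_single, smul_eq_mul, mul_one]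

lemma commutant_of_isSplittingField [Finite G] [NeZero (Nat.card G : k)]
    (hG : IsSplittingField k G) (U : ModuleCat.{t} k[G]) (hU : IsSimpleModule k[G] U)
    (φ : U →ₗ[k] U) (hφ : ∀ g x, φ (Representation.ofModule' (k := k) (G := G) U g x) =
      Representation.ofModule' (k := k) (G := G) U g (φ x)) : ∃ c : k, ∀ x, φ x = c • x := by
  refine IsSplit.exists_eq_smul hG (IsSemisimpleRing.jacobson_eq_bot _) (U := U)
    { toFun := φ, map_add' := map_add φ, map_smul' := fun a x => ?_ }
  induction a using MonoidAlgebra.induction_linear with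
  | zero => simp
  | add a b ha hb =>
    simp only [add_smul, map_add, RingHom.id_apply] at ha hb ⊢
    rw [ha, hb]
  | single g r =>
    rw [RingHom.id_apply, single_smul_eq, single_smul_eq, map_smul]
    exact congrArg _ (hφ g x)

lemma finite_of_isSimpleModule [Finite G] (U : ModuleCat.{t} k[G]) [IsSimpleModule k[G] U] :
    Module.Finite k U :=
  Module.Finite.trans k[G] U

/-- The natural isomorphism `V ⊗ U* ≃ Hom_k(U, V)`. -/
def tensorDualEquiv (V : ModuleCat.{t} k[H]) (U : ModuleCat.{t} k[G]) [Module.Finite k U]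
    [Module.Finite k V] :
    (tensorDual k V U).Equiv (Representation.linHom
      ((Representation.ofModule' (k := k) (G := G) U).comp (MonoidHom.snd H G))
      ((Representation.ofModule' (k := k) (G := H) V).comp (MonoidHom.fst H G))) :=
  tprodDualEquivLinHom _ _

lemma tensorDual_nontrivial (V : ModuleCat.{t} k[H]) (U : ModuleCat.{t} k[G])
    [IsSimpleModule k[H] V] [IsSimpleModule k[G] U] : Nontrivial (tensorDual k V U).asModule := by
  have : Nontrivial V := IsSimpleModule.nontrivial k[H] V
  have : Nontrivial U := IsSimpleModule.nontrivial k[G] U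
  change Nontrivial (TensorProduct k V (Module.Dual k U))
  infer_instance

variable [Finite G] [Finite H] [NeZero (Nat.card G : k)] [NeZero (Nat.card H : k)]

lemma tensorDual_end_scalar (hG : IsSplittingField k G) (hH : IsSplittingField k H)
    (V : ModuleCat.{t} k[H]) (U : ModuleCat.{t} k[G]) [IsSimpleModule k[H] V]
    [IsSimpleModule k[G] U]
    (φ : (tensorDual k V U).asModule →ₗ[k[H × G]] (tensorDual k V U).asModule) :
    ∃ c : k, ∀ x, φ x = c • x := by
  have := finite_of_isSimpleModule (k := k) U
  have := finite_of_isSimpleModule (k := k) V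
  have : Nontrivial V := IsSimpleModule.nontrivial k[H] V
  let e := tensorDualEquiv V U
  let ψ := (Representation.IntertwiningMap.equivLinearMapAsModule _ _).symm φ
  obtain ⟨c, hc⟩ := linHom_end_scalar _ _
    (commutant_of_isSplittingField hG U ‹_›) (commutant_of_isSplittingField hH V ‹_›)
    ((e.toIntertwiningMap.comp ψ).comp e.symm.toIntertwiningMap)
  refine ⟨c, fun x => ?_⟩
  have h1 := hc (e x)
  have h2 : ((e.toIntertwiningMap.comp ψ).comp e.symm.toIntertwiningMap) (e x) = e (φ x) :=
    congrArg (fun y => e (φ y)) (e.symm_apply_apply x)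
  rw [h2] at h1
  exact (e.toLinearEquiv.injective (h1.trans (map_smul e.toLinearEquiv c x).symm))

/-- The multiplicity of `V ⊗ U*` is the dimension of a space of intertwining maps. -/
theorem multiplicity_tensorDual (hG : IsSplittingField k G) (hH : IsSplittingField k H)
    (V : ModuleCat.{t} k[H]) (U : ModuleCat.{t} k[G]) [IsSimpleModule k[H] V]
    [IsSimpleModule k[G] U] {W : Type*} [AddCommGroup W] [Module k W] [Module.Finite k W]
    (ω : Representation k (H × G) W) :
    multiplicity k[H × G] ω.asModule (tensorDual k V U).asModule =
      Cardinal.toENat (Module.rank k (ω.IntertwiningMap (Representation.linHom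
        ((Representation.ofModule' (k := k) (G := G) U).comp (MonoidHom.snd H G))
        ((Representation.ofModule' (k := k) (G := H) V).comp (MonoidHom.fst H G))))) := by
  have := finite_of_isSimpleModule (k := k) U
  have := finite_of_isSimpleModule (k := k) V
  have : NeZero (Nat.card (H × G) : k) := by
    rw [Nat.card_prod, Nat.cast_mul]; infer_instance
  have := tensorDual_nontrivial V U
  have hT := tensorDual_end_scalar hG hH V U
  -- Simplicity comes from the scalar endomorphisms together with Maschke for H × G, whose order is
  -- nonzero in k.
  have : IsSimpleModule k[H × G] (tensorDual k V U).asModule := isSimpleModule_of_scalar_end hT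
  have : Module.Finite k[H × G] ω.asModule := Module.Finite.of_restrictScalars_finite k _ _
  let e := tensorDualEquiv V U
  let e' : ω.IntertwiningMap (tensorDual k V U) ≃ₗ[k] ω.IntertwiningMap (Representation.linHom
        ((Representation.ofModule' (k := k) (G := G) U).comp (MonoidHom.snd H G))
        ((Representation.ofModule' (k := k) (G := H) V).comp (MonoidHom.fst H G))) :=
    { toFun := fun f => e.toIntertwiningMap.comp f
      invFun := fun f => e.symm.toIntertwiningMap.comp f
      map_add' := fun f g => Representation.IntertwiningMap.add_comp _ _ _ _ _ _
      map_smul' := fun c f => Representation.IntertwiningMap.comp_smul _ _ _ _ _ _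
      left_inv := fun f => Representation.IntertwiningMap.ext (LinearMap.ext fun x =>
        e.symm_apply_apply (f x))
      right_inv := fun f => Representation.IntertwiningMap.ext (LinearMap.ext fun x =>
        e.apply_symm_apply (f x)) }
  rw [multiplicity_eq_finrank hT,
    ← (Representation.IntertwiningMap.equivLinearMapAsModule ω _).rank_eq]
  simpa using congrArg Cardinal.toENat e'.lift_rank_eq

end SplittingField

/-! ### The radical of the category algebra -/

namespace CategoryAlgebra

variable {k : Type w} {C : Type u} [Field k] [Category.{v} C]

variable (k) in
/-- The inclusion into `kC` of the span of the morphisms from `c` to `d`. -/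
def incl (c d : C) : ((c ⟶ d) →₀ k) →ₗ[k] CategoryAlgebra k C :=
  open Classical in
  (LinearMap.single k (fun c => (d : C) → ((c ⟶ d) →₀ k)) c).comp
    (LinearMap.single k (fun d => ((c ⟶ d) →₀ k)) d)

lemma incl_single {c d : C} (f : c ⟶ d) (r : k) : incl k c d (Finsupp.single f r) = single f r :=
  rfl

lemma single_eq_smul {c d : C} (f : c ⟶ d) (r : k) : single f r = r • single f 1 := by
  rw [← incl_single, ← incl_single, ← map_smul, Finsupp.smul_single, smul_eq_mul, mul_one]

lemma linearMap_ext [Fintype C] {M : Type*} [AddCommMonoid M] [Module k M]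
    {φ ψ : CategoryAlgebra k C →ₗ[k] M}
    (h : ∀ (c d : C) (f : c ⟶ d), φ (single f 1) = ψ (single f 1)) : φ = ψ := by
  classical
  refine LinearMap.pi_ext' fun c => LinearMap.pi_ext' fun d => Finsupp.lhom_ext fun f r => ?_
  change φ (single f r) = ψ (single f r)
  rw [single_eq_smul, map_smul, map_smul, h]

lemma bilinear_ext [Fintype C] {M : Type*} [AddCommMonoid M] [Module k M]
    {φ ψ : CategoryAlgebra k C →ₗ[k] CategoryAlgebra k C →ₗ[k] M}
    (h : ∀ (c d : C) (f : c ⟶ d) (a b : C) (g : a ⟶ b),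
      φ (single f 1) (single g 1) = ψ (single f 1) (single g 1)) : φ = ψ :=
  linearMap_ext fun c d f => linearMap_ext fun a b g => h c d f a b g

end CategoryAlgebra

section Radical

variable (k : Type w) {C : Type u} [Field k] [Category.{v} C] [Fintype C] [IsEI C]

/-- The inclusion of the group algebra of `C(c, c)` into the category algebra. -/
def ofGroupAlgebra (c : C) : k[End c] →ₗ[k] CategoryAlgebra k C :=
  (CategoryAlgebra.incl k c c).comp (MonoidAlgebra.coeffLinearEquiv k).toLinearMap

omit [IsEI C] in
variable {k} in
lemma ofGroupAlgebra_single {c : C} (f : End c) (r : k) :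
    ofGroupAlgebra k c (MonoidAlgebra.single f r) = CategoryAlgebra.single f.asHom r := rfl

omit [IsEI C] in
lemma ofGroupAlgebra_one (c : C) : ofGroupAlgebra k c 1 = CategoryAlgebra.single (𝟙 c) 1 := rfl

omit [IsEI C] in
variable {k} in
lemma ofGroupAlgebra_mul {c : C} (x y : k[End c]) :
    ofGroupAlgebra k c (x * y) = ofGroupAlgebra k c x * ofGroupAlgebra k c y := by
  induction x using MonoidAlgebra.induction_linear with
  | zero => simp
  | add x x' hx hx' => simp only [add_mul, map_add, hx, hx']
  | single f r =>
    induction y using MonoidAlgebra.induction_linear with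
    | zero => simp
    | add y y' hy hy' => simp only [mul_add, map_add, hy, hy']
    | single g s =>
      rw [MonoidAlgebra.single_mul_single, ofGroupAlgebra_single, ofGroupAlgebra_single,
        ofGroupAlgebra_single, CategoryAlgebra.single_mul_single]
      rfl

omit [IsEI C] in
variable {k} in
lemma ofGroupAlgebra_mul_of_ne {c d : C} (h : c ≠ d) (x : k[End c]) (y : k[End d]) :
    ofGroupAlgebra k c x * ofGroupAlgebra k d y = 0 := by
  induction x using MonoidAlgebra.induction_linear with
  | zero => simp
  | add x x' hx hx' => simp only [add_mul, map_add, hx, hx', add_zero]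
  | single f r =>
    induction y using MonoidAlgebra.induction_linear with
    | zero => simp
    | add y y' hy hy' => simp only [mul_add, map_add, hy, hy', add_zero]
    | single g s => exact CategoryAlgebra.single_mul_single_of_ne _ _ _ _ h.symm

/-- The inclusion into `kC` of the product of the group algebras of the groups `C(c, c)`. -/
def ofGroupAlgebras : ((c : C) → k[End c]) →ₐ[k] CategoryAlgebra k C :=
  AlgHom.ofLinearMap
    (∑ c : C, (ofGroupAlgebra k c).comp (LinearMap.proj c))
    (by
      simp only [LinearMap.sum_apply, LinearMap.comp_apply, LinearMap.proj_apply, Pi.one_apply,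
        ofGroupAlgebra_one, CategoryAlgebra.one_eq_sum])
    (fun x y => by
      simp only [LinearMap.sum_apply, LinearMap.comp_apply, LinearMap.proj_apply, Pi.mul_apply,
        ofGroupAlgebra_mul, Finset.sum_mul_sum]
      refine Finset.sum_congr rfl fun c _ => ?_
      rw [Finset.sum_eq_single c (fun d _ hd => ofGroupAlgebra_mul_of_ne hd.symm _ _) (by simp)])

omit [IsEI C] in
lemma ofGroupAlgebras_apply (x : (c : C) → k[End c]) :
    ofGroupAlgebras k x = ∑ c : C, ofGroupAlgebra k c (x c) := by
  simp [ofGroupAlgebras]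

variable (hC : Skeletal C)

lemma toGroupAlgebra_ofGroupAlgebra (c : C) (x : k[End c]) :
    toGroupAlgebra k hC c (ofGroupAlgebra k c x) = x := by
  induction x using MonoidAlgebra.induction_linear with
  | zero => simp
  | add x x' hx hx' => rw [map_add, map_add, hx, hx']
  | single f r => exact toGroupAlgebra_single k hC _ _

lemma toGroupAlgebra_ofGroupAlgebra_of_ne {c d : C} (h : c ≠ d) (x : k[End d]) :
    toGroupAlgebra k hC c (ofGroupAlgebra k d x) = 0 := by
  induction x using MonoidAlgebra.induction_linear with
  | zero => simp
  | add x x' hx hx' => rw [map_add, map_add, hx, hx', add_zero]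
  | single f r => exact toGroupAlgebra_single_of_ne_left k hC _ _ h

/-- The projection from `kC` to the product of the group algebras of the groups `C(c, c)`. -/
def toGroupAlgebras : CategoryAlgebra k C →ₐ[k] ((c : C) → k[End c]) :=
  AlgHom.pi fun c => toGroupAlgebra k hC c

lemma toGroupAlgebras_ofGroupAlgebras (x : (c : C) → k[End c]) :
    toGroupAlgebras k hC (ofGroupAlgebras k x) = x := by
  funext c
  change toGroupAlgebra k hC c _ = _
  rw [ofGroupAlgebras_apply, map_sum, Finset.sum_eq_single c
    (fun d _ hd => toGroupAlgebra_ofGroupAlgebra_of_ne k hC hd.symm _) (by simp),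
    toGroupAlgebra_ofGroupAlgebra]

lemma toGroupAlgebras_surjective : Function.Surjective (toGroupAlgebras k hC) :=
  fun x => ⟨_, toGroupAlgebras_ofGroupAlgebras k hC x⟩

/-- The number of objects with a morphism to `d`. -/
def height (d : C) : ℕ := Nat.card {c : C // Nonempty (c ⟶ d)}

omit [IsEI C] in
lemma height_le_card (d : C) : height d ≤ Fintype.card C := by
  rw [height, ← Nat.card_eq_fintype_card]
  exact Nat.card_le_card_of_injective _ Subtype.val_injective

omit [IsEI C] in
lemma height_pos (d : C) : 0 < height d := by
  have : Nonempty {c : C // Nonempty (c ⟶ d)} := ⟨⟨d, ⟨𝟙 d⟩⟩⟩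
  exact Nat.card_pos

omit [IsEI C] in
lemma height_le {c d : C} (f : c ⟶ d) : height c ≤ height d :=
  Nat.card_mono (Set.toFinite {e : C | Nonempty (e ⟶ d)}) fun _ ⟨g⟩ => ⟨g ≫ f⟩

include hC in
-- The object d itself maps to d but not to c, by `eq_of_hom_hom`.
lemma height_lt {c d : C} (f : c ⟶ d) (h : c ≠ d) : height c < height d := by
  refine Set.ncard_lt_ncard (s := {e : C | Nonempty (e ⟶ c)}) (t := {e : C | Nonempty (e ⟶ d)})
    ⟨fun _ ⟨g⟩ => ⟨g ≫ f⟩, fun hle => ?_⟩ (Set.toFinite _)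
  obtain ⟨g⟩ := hle (show d ∈ {e : C | Nonempty (e ⟶ d)} from ⟨𝟙 d⟩)
  exact h (eq_of_hom_hom hC f g)

variable {k} in
/-- The elements of `kC` that raise the height by at least `n`. -/
def RaisesHeight (n : ℕ) (x : CategoryAlgebra k C) : Prop :=
  ∀ c d : C, height d < height c + n → x.hom c d = 0

variable {k}

omit [IsEI C] in
lemma raisesHeight_zero (x : CategoryAlgebra k C) : RaisesHeight 0 x := fun c d h =>
  Finsupp.ext fun f => absurd (height_le (c := c) (d := d) f) (by omega)

omit [IsEI C] in
lemma RaisesHeight.mul {m n : ℕ} {x y : CategoryAlgebra k C} (hx : RaisesHeight m x)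
    (hy : RaisesHeight n y) : RaisesHeight (m + n) (x * y) := fun c d h => by
  rw [CategoryAlgebra.hom_mul]
  refine Finset.sum_eq_zero fun e _ => ?_
  by_cases hce : height e < height c + n
  · rw [hy c e hce, Limits.zero_comp]
  · rw [hx e d (by omega), Limits.comp_zero]

omit [IsEI C] in
lemma RaisesHeight.isNilpotent {x : CategoryAlgebra k C} (hx : RaisesHeight 1 x) :
    IsNilpotent x := by
  have h : ∀ n, RaisesHeight n (x ^ n) := fun n => by
    induction n with
    | zero => exact raisesHeight_zero _
    | succ n ih => rw [pow_succ]; exact ih.mul hx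
  -- Heights lie between 1 and |C|, so no morphism raises the height by |C|.
  refine ⟨Fintype.card C, CategoryAlgebra.ext fun c d => h _ c d ?_⟩
  have := height_le_card d
  have := height_pos c
  omega

lemma raisesHeight_one_of_mem_ker {x : CategoryAlgebra k C}
    (hx : toGroupAlgebras k hC x = 0) : RaisesHeight 1 x := fun c d h => by
  by_cases hcd : c = d
  · subst hcd
    exact congrArg MonoidAlgebra.coeff (congrFun hx c)
  · refine Finsupp.ext fun f => absurd (height_lt hC (c := c) (d := d) f hcd) (by omega)

variable [∀ c d : C, Finite (c ⟶ d)] [∀ c : C, NeZero (Nat.card (End c) : k)]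

instance (c : C) : Finite (End c) := inferInstanceAs (Finite (c ⟶ c))

/-- A surjection carries the radical into the radical of the semisimple target, which is zero.
Conversely, if x lies in the kernel then every y * x raises the height, so it is nilpotent and 1 + y
* x is invertible. -/
theorem jacobson_categoryAlgebra :
    Ring.jacobson (CategoryAlgebra k C) = RingHom.ker (toGroupAlgebras k hC) := by
  apply le_antisymm
  · let f := (toGroupAlgebras k hC).toRingHom
    have : RingHomSurjective f := ⟨toGroupAlgebras_surjective k hC⟩
    have h := Ring.le_comap_jacobson f
    rw [IsSemisimpleRing.jacobson_eq_bot ((c : C) → k[End c])] at h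
    exact h
  · intro x hx
    rw [← Ideal.jacobson_bot, Ideal.mem_jacobson_iff]
    intro y
    have h := ((raisesHeight_zero y).mul (raisesHeight_one_of_mem_ker hC hx)).isNilpotent
    obtain ⟨z, hz⟩ := h.isUnit_one_add.exists_left_inv
    refine ⟨z, (Submodule.mem_bot _).mpr ?_⟩
    rw [mul_add, mul_one] at hz
    rw [sub_eq_zero, mul_assoc, add_comm, hz]

lemma IsSplit.of_algEquiv_pi {A ι : Type*} [Ring A] [Algebra k A] [Fintype ι] {d : ι → ℕ}
    (e : (A ⧸ Ring.jacobson A) ≃ₐ[k] ((i : ι) → Matrix (Fin (d i)) (Fin (d i)) k)) :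
    IsSplit k A :=
  ⟨Fintype.card ι, fun i => d ((Fintype.equivFin ι).symm i),
    ⟨e.trans (AlgEquiv.piCongrLeft' k (fun i => Matrix (Fin (d i)) (Fin (d i)) k)
      (Fintype.equivFin ι))⟩⟩

include hC in
theorem isSplit_categoryAlgebra (hsplit : ∀ c : C, IsSplittingField k (End c)) :
    IsSplit k (CategoryAlgebra k C) := by
  choose n d e using hsplit
  have e₀ : (c : C) → (k[End c] ≃ₐ[k] (k[End c] ⧸ Ring.jacobson k[End c])) := fun c =>
    AlgEquiv.ofBijective (Ideal.Quotient.mkₐ k (Ring.jacobson k[End c]))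
      ⟨(RingHom.injective_iff_ker_eq_bot _).mpr (by
        rw [← IsSemisimpleRing.jacobson_eq_bot k[End c]]; exact Ideal.mk_ker),
        Ideal.Quotient.mkₐ_surjective k _⟩
  have e₁ : (CategoryAlgebra k C ⧸ Ring.jacobson (CategoryAlgebra k C)) ≃ₐ[k]
      ((c : C) → k[End c]) :=
    (Ideal.quotientEquivAlgOfEq k (jacobson_categoryAlgebra hC)).trans
      (Ideal.quotientKerAlgEquivOfSurjective (toGroupAlgebras_surjective k hC))
  have e₂ := e₁.trans (AlgEquiv.piCongrRight fun c => (e₀ c).trans (e c).some)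
  exact IsSplit.of_algEquiv_pi (ι := Σ c, Fin (n c)) (d := fun p => d p.1 p.2)
    (e₂.trans
      (AlgEquiv.ofLinearEquiv (LinearEquiv.piCurry k
        (fun (c : C) (i : Fin (n c)) => Matrix (Fin (d c i)) (Fin (d c i)) k))
        rfl fun _ _ => rfl).symm)

end Radical

/-! ### Simple modules of the category algebra -/

section Vertices

variable {k : Type w} {C : Type u} [Field k] [Category.{v} C] [Fintype C] [IsEI C]
  (hC : Skeletal C)

lemma inflation_smul (c : C) (U : ModuleCat.{t} k[End c]) (a : CategoryAlgebra k C)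
    (x : (inflation k hC c).obj U) :
    a • x = @HSMul.hSMul k[End c] U U _ (toGroupAlgebra k hC c a) x := rfl

lemma inflation_ofGroupAlgebra_smul (c : C) (U : ModuleCat.{t} k[End c]) (r : k[End c])
    (x : (inflation k hC c).obj U) :
    ofGroupAlgebra k c r • x = @HSMul.hSMul k[End c] U U _ r x := by
  rw [inflation_smul, toGroupAlgebra_ofGroupAlgebra]

lemma inflation_ofGroupAlgebra_smul_of_ne {c d : C} (h : c ≠ d) (U : ModuleCat.{t} k[End c])
    (r : k[End d]) (x : (inflation k hC c).obj U) : ofGroupAlgebra k d r • x = 0 := by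
  rw [inflation_smul, toGroupAlgebra_ofGroupAlgebra_of_ne k hC h]
  exact @zero_smul k[End c] U _ _ _ x

/-- The restriction along `inflation` of an isomorphism. -/
def isoOfInflationIso (c : C) (U V : ModuleCat.{t} k[End c])
    (e : (inflation k hC c).obj U ≅ (inflation k hC c).obj V) : U ≅ V :=
  LinearEquiv.toModuleIso
    { toFun := fun x => e.toLinearEquiv x
      invFun := fun x => e.toLinearEquiv.symm x
      map_add' := fun x y => map_add e.toLinearEquiv x y
      map_smul' := fun r x => by
        have h (y : (inflation k hC c).obj U) := (map_smul e.toLinearEquiv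
          (ofGroupAlgebra k c r) y).trans (inflation_ofGroupAlgebra_smul hC c V r _)
        exact (congrArg e.toLinearEquiv
          (inflation_ofGroupAlgebra_smul hC c U r x).symm).trans (h x)
      left_inv := fun x => e.toLinearEquiv.left_inv x
      right_inv := fun x => e.toLinearEquiv.right_inv x }

/-- The identity of c acts as 1 on modules inflated from c and as 0 on those inflated from other
objects, so the class of the inflation determines c. -/
theorem vertexMap_injective : Function.Injective (vertexMap.{t} k hC) := by
  rintro ⟨c, x⟩ ⟨d, y⟩ h
  induction x using Quotient.inductionOn with | _ U =>
  induction y using Quotient.inductionOn with | _ V =>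
  obtain ⟨e⟩ : Nonempty ((inflation k hC c).obj U.1 ≅ (inflation k hC d).obj V.1) :=
    Quotient.exact h
  by_cases hcd : c = d
  · subst hcd
    exact congrArg _ (Quotient.sound ⟨isoOfInflationIso hC c U.1 V.1 e⟩)
  · exfalso
    have := isSimpleModule_inflation k hC c U.1 U.2
    have := IsSimpleModule.nontrivial (CategoryAlgebra k C) ((inflation k hC c).obj U.1)
    obtain ⟨x, hx⟩ := exists_ne (0 : (inflation k hC c).obj U.1)
    have h1 : ofGroupAlgebra k c 1 • x = x :=
      (inflation_ofGroupAlgebra_smul hC c U.1 1 x).trans (@one_smul k[End c] U.1 _ _ x)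
    have h2 := map_smul e.hom.hom (ofGroupAlgebra k c 1) x
    rw [inflation_ofGroupAlgebra_smul_of_ne hC (Ne.symm hcd), h1] at h2
    exact hx (e.toLinearEquiv.injective (h2.trans (map_zero e.toLinearEquiv).symm))

variable {S : Type t} [AddCommGroup S] [Module (CategoryAlgebra k C) S]

/-- a and σπ(a) differ by an element of ker π. -/
lemma smul_eq_of_ker_smul
    (hS : ∀ a, toGroupAlgebras k hC a = 0 → ∀ x : S, a • x = 0) (a : CategoryAlgebra k C) (x : S) :
    a • x = ofGroupAlgebras k (toGroupAlgebras k hC a) • x := by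
  rw [← sub_eq_zero, ← sub_smul]
  exact hS _ (by rw [map_sub, toGroupAlgebras_ofGroupAlgebras, sub_self]) x

lemma smul_eq_ofGroupAlgebra_smul
    (hS : ∀ a, toGroupAlgebras k hC a = 0 → ∀ x : S, a • x = 0) {c : C}
    (hc : ∀ x : S, ofGroupAlgebra k c 1 • x = x) (a : CategoryAlgebra k C) (x : S) :
    a • x = ofGroupAlgebra k c (toGroupAlgebra k hC c a) • x := by
  rw [smul_eq_of_ker_smul hC hS, ofGroupAlgebras_apply, Finset.sum_smul,
    Finset.sum_eq_single c _ (by simp)]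
  · rfl
  · intro d _ hd
    rw [← hc x, smul_smul, ofGroupAlgebra_mul_of_ne hd, zero_smul]

/-- Modulo ker π the identity of c is a central idempotent, so it acts on S by an endomorphism. Some
identity acts nontrivially, since they sum to 1. By Schur it is injective, and an injective
idempotent is the identity. -/
lemma exists_ofGroupAlgebra_one_smul [IsSimpleModule (CategoryAlgebra k C) S]
    (hS : ∀ a, toGroupAlgebras k hC a = 0 → ∀ x : S, a • x = 0) :
    ∃ c : C, ∀ x : S, ofGroupAlgebra k c 1 • x = x := by
  have : Nontrivial S := IsSimpleModule.nontrivial (CategoryAlgebra k C) S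
  obtain ⟨x, hx⟩ := exists_ne (0 : S)
  obtain ⟨c, hc⟩ : ∃ c : C, ofGroupAlgebra k c 1 • x ≠ 0 := by
    by_contra! h
    apply hx
    rw [← one_smul (CategoryAlgebra k C) x, CategoryAlgebra.one_eq_sum, Finset.sum_smul]
    exact Finset.sum_eq_zero fun c _ => h c
  refine ⟨c, ?_⟩
  have hcomm : ∀ b : (c : C) → k[End c], ofGroupAlgebra k c 1 * ofGroupAlgebras k b =
      ofGroupAlgebras k b * ofGroupAlgebra k c 1 := fun b => by
    rw [ofGroupAlgebras_apply, Finset.mul_sum, Finset.sum_mul]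
    refine Finset.sum_congr rfl fun d _ => ?_
    by_cases hd : c = d
    · subst hd
      rw [← ofGroupAlgebra_mul, ← ofGroupAlgebra_mul, one_mul, mul_one]
    · rw [ofGroupAlgebra_mul_of_ne hd, ofGroupAlgebra_mul_of_ne (Ne.symm hd)]
  let φ : S →ₗ[CategoryAlgebra k C] S :=
    { toFun := fun x => ofGroupAlgebra k c 1 • x
      map_add' := smul_add _
      map_smul' := fun a x => by
        rw [RingHom.id_apply, smul_eq_of_ker_smul hC hS a x, smul_eq_of_ker_smul hC hS a,
          smul_smul, hcomm, mul_smul] }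
  have hφ : Function.Injective φ := (LinearMap.injective_or_eq_zero φ).resolve_right fun h =>
    hc (LinearMap.congr_fun h x)
  intro y
  apply hφ
  change ofGroupAlgebra k c 1 • ofGroupAlgebra k c 1 • y = ofGroupAlgebra k c 1 • y
  rw [smul_smul, ← ofGroupAlgebra_mul, one_mul]

/-- A `kC`-module supported on the object `c` is a module over the group algebra of `C(c, c)`. -/
abbrev moduleOfSupported {c : C} (hc : ∀ x : S, ofGroupAlgebra k c 1 • x = x) :
    Module k[End c] S where
  smul r x := ofGroupAlgebra k c r • x
  one_smul := hc
  mul_smul r s x := by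
    change ofGroupAlgebra k c (r * s) • x = ofGroupAlgebra k c r • ofGroupAlgebra k c s • x
    rw [ofGroupAlgebra_mul, mul_smul]
  smul_zero r := smul_zero _
  smul_add r := smul_add _
  add_smul r s x := by
    change ofGroupAlgebra k c (r + s) • x = ofGroupAlgebra k c r • x + ofGroupAlgebra k c s • x
    rw [map_add, add_smul]
  zero_smul x := by
    change ofGroupAlgebra k c 0 • x = 0
    rw [map_zero, zero_smul]

/-- The module over the group algebra of `C(c, c)` given by a `kC`-module supported on `c`. -/
def supportedModule {c : C} (hc : ∀ x : S, ofGroupAlgebra k c 1 • x = x) :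
    ModuleCat.{t} k[End c] :=
  letI := moduleOfSupported hc
  ModuleCat.of k[End c] S

/-- A `kC`-module supported on `c` that is killed by the radical is an inflation. -/
def inflationSupportedModule (hS : ∀ a, toGroupAlgebras k hC a = 0 → ∀ x : S, a • x = 0) {c : C}
    (hc : ∀ x : S, ofGroupAlgebra k c 1 • x = x) :
    (inflation k hC c).obj (supportedModule hc) ≃ₗ[CategoryAlgebra k C] S where
  toFun x := x
  invFun x := x
  map_add' _ _ := rfl
  map_smul' a x := (smul_eq_ofGroupAlgebra_smul hC hS hc a (show S from x)).symm
  left_inv _ := rfl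
  right_inv _ := rfl

lemma isSimpleModule_supportedModule [IsSimpleModule (CategoryAlgebra k C) S]
    (hS : ∀ a, toGroupAlgebras k hC a = 0 → ∀ x : S, a • x = 0) {c : C}
    (hc : ∀ x : S, ofGroupAlgebra k c 1 • x = x) :
    IsSimpleModule k[End c] (supportedModule hc) := by
  let f := (toGroupAlgebra k hC c).toRingHom
  have : RingHomSurjective f := ⟨toGroupAlgebra_surjective k hC c⟩
  let l : S →ₛₗ[f] supportedModule hc :=
    { toFun := fun x => x
      map_add' := fun _ _ => rfl
      map_smul' := smul_eq_ofGroupAlgebra_smul hC hS hc }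
  exact (l.isSimpleModule_iff_of_bijective Function.bijective_id).mp inferInstance

variable [∀ c d : C, Finite (c ⟶ d)] [∀ c : C, NeZero (Nat.card (End c) : k)]

theorem vertexMap_surjective : Function.Surjective (vertexMap.{t} k hC) := by
  intro y
  induction y using Quotient.inductionOn with | _ S =>
  have := S.2
  have hS : ∀ a, toGroupAlgebras k hC a = 0 → ∀ x : S.1, a • x = 0 := fun a ha x => by
    have h : a ∈ Ring.jacobson (CategoryAlgebra k C) := by
      rw [jacobson_categoryAlgebra hC]
      exact ha
    exact Module.mem_annihilator.mp
      (IsSemisimpleModule.jacobson_le_annihilator (CategoryAlgebra k C) S.1 h) x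
  obtain ⟨c, hc⟩ := exists_ofGroupAlgebra_one_smul hC hS
  exact ⟨⟨c, Irr.mk ⟨supportedModule hc, isSimpleModule_supportedModule hC hS hc⟩⟩,
    Quotient.sound ⟨(inflationSupportedModule hC hS hc).toModuleIso⟩⟩

end Vertices

/-! ### Irreducible morphisms in a skeletal EI-category -/

section Irreducible

variable {C : Type u} [Category.{v} C] [IsEI C]

lemma not_isIrredHom_endo {c : C} (f : c ⟶ c) : ¬ IsIrredHom f := fun h => by
  have := IsEI.isIso_endo f
  exact h.not_splitMono inferInstance

lemma eq_of_isSplitMono (hC : Skeletal C) {c d : C} (f : c ⟶ d) (h : IsSplitMono f) : c = d :=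
  eq_of_hom_hom hC f (retraction f)

lemma eq_of_isSplitEpi (hC : Skeletal C) {c d : C} (f : c ⟶ d) (h : IsSplitEpi f) : c = d :=
  eq_of_hom_hom hC f (section_ f)

/-- Split monomorphisms and split epimorphisms are endomorphisms here, and all endomorphisms are
invertible. So between distinct objects, reducible means factoring through a third object. -/
lemma exists_comp_of_not_isIrredHom (hC : Skeletal C) {c d : C} (hcd : c ≠ d) (f : c ⟶ d)
    (hf : ¬ IsIrredHom f) :
    ∃ (e : C) (h : c ⟶ e) (g : e ⟶ d), f = h ≫ g ∧ c ≠ e ∧ e ≠ d := by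
  by_contra! hcon
  refine hf ⟨fun h => hcd (eq_of_isSplitMono hC f h), fun h => hcd (eq_of_isSplitEpi hC f h),
    fun {e} h g hfac => ?_⟩
  by_cases hce : c = e
  · subst hce
    have := IsEI.isIso_endo h
    exact Or.inl inferInstance
  · obtain rfl := hcon e h g hfac hce
    have := IsEI.isIso_endo g
    exact Or.inr inferInstance

lemma not_isIrredHom_comp (hC : Skeletal C) {c d e : C} (h : c ⟶ e) (g : e ⟶ d) (hce : c ≠ e)
    (hed : e ≠ d) : ¬ IsIrredHom (h ≫ g) := fun hf =>
  (hf.splitMono_or_splitEpi h g rfl).elim (fun h' => hce (eq_of_isSplitMono hC h h'))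
    fun h' => hed (eq_of_isSplitEpi hC g h')

lemma isIrredHom_endo_comp_iff {c d : C} (g : c ⟶ c) (f : c ⟶ d) :
    IsIrredHom (g ≫ f) ↔ IsIrredHom f := by
  have := IsEI.isIso_endo g
  refine ⟨fun h => ?_, fun h => ?_⟩
  · simpa using h.iso_comp_iso (inv g) (𝟙 d)
  · simpa using h.iso_comp_iso g (𝟙 d)

lemma isIrredHom_comp_endo_iff {c d : C} (f : c ⟶ d) (g : d ⟶ d) :
    IsIrredHom (f ≫ g) ↔ IsIrredHom f := by
  have := IsEI.isIso_endo g
  refine ⟨fun h => ?_, fun h => ?_⟩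
  · simpa using h.iso_comp_iso (𝟙 c) (inv g)
  · simpa using h.iso_comp_iso (𝟙 c) g

lemma irredHom_smul_val {c d : C} (p : End d × End c) (f : IrredHom c d) :
    (p • f).1 = (p.2⁻¹).asHom ≫ f.1 ≫ p.1.asHom := rfl

end Irreducible

/-! ### Derivations of the category algebra as equivariant maps on irreducible morphisms -/

section HomRep

variable (k : Type w) {C : Type u} [Field k] [Category.{v} C] [IsEI C] (c c' : C)
  (U V : Type*) [AddCommGroup U] [AddCommGroup V]
  [Module k U] [Module k V] [Module k[End c] U] [IsScalarTower k k[End c] U]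
  [Module k[End c'] V] [IsScalarTower k k[End c'] V]

/-- The action of `C(c', c') × C(c, c)` on `Hom_k(U, V)`. -/
abbrev homRep : Representation k (End c' × End c) (U →ₗ[k] V) :=
  Representation.linHom
    ((Representation.ofModule' (k := k) (G := End c) U).comp (MonoidHom.snd (End c') (End c)))
    ((Representation.ofModule' (k := k) (G := End c') V).comp (MonoidHom.fst (End c') (End c)))

variable {k c c' U V} in
lemma homRep_apply (p : End c' × End c) (x : U →ₗ[k] V) (u : U) :
    homRep k c c' U V p x u =
      MonoidAlgebra.of k (End c') p.1 • x (MonoidAlgebra.of k (End c) p.2⁻¹ • u) := rfl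

end HomRep

section Derivations

set_option linter.unusedSectionVars false

open CategoryAlgebra

variable {k : Type w} {C : Type u} [Field k] [Category.{v} C] [Fintype C] [IsEI C]
  (hC : Skeletal C) {c c' : C} {U V : Type*} [AddCommGroup U] [AddCommGroup V]
  [Module k U] [Module k V] [Module k[End c] U] [IsScalarTower k k[End c] U]
  [Module k[End c'] V] [IsScalarTower k k[End c'] V]
  [Module (CategoryAlgebra k C) U] [IsScalarTower k (CategoryAlgebra k C) U]
  [Module (CategoryAlgebra k C) V] [IsScalarTower k (CategoryAlgebra k C) V]

/-- The `kC`-module `U` is the inflation of a module over the group algebra of `C(c, c)`. -/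
def IsInflation (c : C) (U : Type*) [AddCommGroup U] [Module k[End c] U]
    [Module (CategoryAlgebra k C) U] : Prop :=
  ∀ (a : CategoryAlgebra k C) (x : U), a • x = toGroupAlgebra k hC c a • x

variable {hC}

lemma IsInflation.single_smul {c : C} {U : Type*} [AddCommGroup U] [Module k[End c] U]
    [Module (CategoryAlgebra k C) U] (hU : IsInflation (k := k) hC c U) (f : End c) (x : U) :
    (single f.asHom 1 : CategoryAlgebra k C) • x = MonoidAlgebra.of k (End c) f • x := by
  rw [hU, toGroupAlgebra_single]
  rfl

lemma IsInflation.single_smul_of_ne_left {c : C} {U : Type*} [AddCommGroup U] [Module k[End c] U]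
    [Module (CategoryAlgebra k C) U] (hU : IsInflation (k := k) hC c U) {a b : C} (f : a ⟶ b)
    (h : a ≠ c) (x : U) : (single f 1 : CategoryAlgebra k C) • x = 0 := by
  rw [hU, toGroupAlgebra_single_of_ne_left k hC f 1 h.symm, zero_smul]

lemma IsInflation.single_smul_of_ne_right {c : C} {U : Type*} [AddCommGroup U] [Module k[End c] U]
    [Module (CategoryAlgebra k C) U] (hU : IsInflation (k := k) hC c U) {a b : C} (f : a ⟶ b)
    (h : b ≠ c) (x : U) : (single f 1 : CategoryAlgebra k C) • x = 0 := by
  rw [hU, toGroupAlgebra_single_of_ne_right k hC f 1 h.symm, zero_smul]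

lemma ofGroupAlgebras_pi_single {c : C} [DecidableEq C] (f : End c) :
    ofGroupAlgebras k (Pi.single c (MonoidAlgebra.single f 1)) =
      (single f.asHom 1 : CategoryAlgebra k C) := by
  rw [ofGroupAlgebras_apply, Finset.sum_eq_single c]
  · rw [Pi.single_eq_same, ofGroupAlgebra_single]
  · intro d _ hd
    rw [Pi.single_eq_of_ne hd, map_zero]
  · simp

section

variable {D : CategoryAlgebra k C →ₗ[k] U →ₗ[k] V} (hD : D ∈ relDer k (ofGroupAlgebras k) U V)

include hD

lemma relDer_endo {a : C} (f : a ⟶ a) : D (single f 1) = 0 := by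
  classical
  exact (congrArg D (ofGroupAlgebras_pi_single (End.of f))).symm.trans (hD.2 _)

lemma relDer_comp {a b d : C} (f : b ⟶ d) (g : a ⟶ b) (u : U) :
    D (single (g ≫ f) 1) u = (single f 1 : CategoryAlgebra k C) • D (single g 1) u +
      D (single f 1) ((single g 1 : CategoryAlgebra k C) • u) := by
  rw [← hD.1, single_mul_single, mul_one]

lemma relDer_endo_comp {a b : C} (f : a ⟶ b) (g : a ⟶ a) (u : U) :
    D (single (g ≫ f) 1) u = D (single f 1) ((single g 1 : CategoryAlgebra k C) • u) := by
  rw [relDer_comp hD, relDer_endo hD, LinearMap.zero_apply, smul_zero, zero_add]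

lemma relDer_comp_endo {a b : C} (f : a ⟶ b) (g : b ⟶ b) (u : U) :
    D (single (f ≫ g) 1) u = (single g 1 : CategoryAlgebra k C) • D (single f 1) u := by
  rw [relDer_comp hD, relDer_endo hD, LinearMap.zero_apply, add_zero]

/-- Inserting identities shows that D lives on morphisms c → c'. If such a morphism factors through
a third object, both Leibniz terms vanish, because the factors act as zero on U and on V. -/
lemma relDer_eq_zero (hU : IsInflation (k := k) hC c U) (hV : IsInflation (k := k) hC c' V)
    (h : ∀ f : c ⟶ c', IsIrredHom f → D (single f 1) = 0) : D = 0 := by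
  refine linearMap_ext fun a b f => LinearMap.ext fun u => ?_
  rw [LinearMap.zero_apply, LinearMap.zero_apply]
  by_cases ha : a = c
  · by_cases hb : b = c'
    · subst ha hb
      by_cases hab : a = b
      · subst hab
        rw [relDer_endo hD, LinearMap.zero_apply]
      · by_cases hf : IsIrredHom f
        · rw [h f hf, LinearMap.zero_apply]
        · obtain ⟨e, p, q, rfl, hae, heb⟩ := exists_comp_of_not_isIrredHom hC hab f hf
          rw [relDer_comp hD, hU.single_smul_of_ne_right _ hae.symm,
            hV.single_smul_of_ne_left _ heb, map_zero, add_zero]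
    · rw [← Category.comp_id f, relDer_comp_endo hD, hV.single_smul_of_ne_right _ hb]
  · rw [← Category.id_comp f, relDer_endo_comp hD, hU.single_smul_of_ne_left _ ha, map_zero]

end

/-- The restriction of a derivation to the irreducible morphisms. -/
def relDerToIntertwining (hU : IsInflation (k := k) hC c U) (hV : IsInflation (k := k) hC c' V) :
    relDer k (ofGroupAlgebras k (C := C)) U V →ₗ[k]
      (Representation.ofMulAction k (End c' × End c) (IrredHom c c')).IntertwiningMap
        (homRep k c c' U V) where
  toFun D :=
    { toLinearMap := (Finsupp.linearCombination k
        fun f : IrredHom c c' => D.1 (single f.1 1)).comp (MonoidAlgebra.coeffLinearEquiv k).toLinearMap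
      isIntertwining' := fun p => by
        refine MonoidAlgebra.lhom_ext' fun f => LinearMap.ext_ring (LinearMap.ext fun u => ?_)
        simp only [LinearMap.comp_apply, MonoidAlgebra.lsingle_apply,
          Representation.ofMulAction_single, LinearEquiv.coe_coe,
          MonoidAlgebra.coeffLinearEquiv_apply, MonoidAlgebra.coeff_single,
          Finsupp.linearCombination_single, one_smul]
        rw [homRep_apply, irredHom_smul_val, relDer_endo_comp D.2, relDer_comp_endo D.2,
          hV.single_smul, hU.single_smul] }
  map_add' D E := by
    refine Representation.IntertwiningMap.ext (MonoidAlgebra.lhom_ext' fun f => LinearMap.ext_ring ?_)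
    simp
  map_smul' r D := by
    refine Representation.IntertwiningMap.ext (MonoidAlgebra.lhom_ext' fun f => LinearMap.ext_ring ?_)
    simp

lemma relDerToIntertwining_single (hU : IsInflation (k := k) hC c U)
    (hV : IsInflation (k := k) hC c' V) (D : relDer k (ofGroupAlgebras k) U V) (f : IrredHom c c') :
    relDerToIntertwining hU hV D (MonoidAlgebra.single f 1) = D.1 (single f.1 1) := by
  change Finsupp.linearCombination k (fun f : IrredHom c c' => D.1 (single f.1 1))
    (Finsupp.single f 1) = _
  rw [Finsupp.linearCombination_single, one_smul]

/-- The projection from `kC` onto the span of the irreducible morphisms from `c` to `c'`. -/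
def irredProj (k : Type w) {C : Type u} [Field k] [Category.{v} C] (c c' : C) :
    CategoryAlgebra k C →ₗ[k] k[IrredHom c c'] where
  toFun x := MonoidAlgebra.ofCoeff (Finsupp.comapDomain Subtype.val (x c c')
    Subtype.val_injective.injOn)
  map_add' x y := by
    ext f
    rfl
  map_smul' r x := by
    ext f
    rfl

lemma coeff_irredProj (x : CategoryAlgebra k C) (f : IrredHom c c') :
    (irredProj k c c' x).coeff f = x c c' f.1 := rfl

lemma irredProj_single (f : IrredHom c c') :
    irredProj k c c' (single f.1 1) = MonoidAlgebra.single f 1 := by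
  classical
  ext g
  have h : (single f.1 1 : CategoryAlgebra k C) c c' = Finsupp.single f.1 1 := hom_single_self _ _
  rw [coeff_irredProj, h, MonoidAlgebra.coeff_single, Finsupp.single_apply,
    Finsupp.single_apply]
  simp only [Subtype.ext_iff]

lemma irredProj_single_of_not {f : c ⟶ c'} (hf : ¬ IsIrredHom f) :
    irredProj k c c' (single f 1) = 0 := by
  classical
  ext g
  have h : (single f 1 : CategoryAlgebra k C) c c' = Finsupp.single f 1 := hom_single_self _ _
  rw [coeff_irredProj, h, Finsupp.single_eq_of_ne (by rintro h'; exact hf (h' ▸ g.2))]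
  rfl

lemma irredProj_single_of_ne_left {a b : C} (f : a ⟶ b) (h : a ≠ c) :
    irredProj k c c' (single f 1) = 0 := by
  ext g
  exact DFunLike.congr_fun (F := (c ⟶ c') →₀ k) (hom_single_of_ne_left f (1 : k) c' h.symm) g.1

lemma irredProj_single_of_ne_right {a b : C} (f : a ⟶ b) (h : b ≠ c') :
    irredProj k c c' (single f 1) = 0 := by
  ext g
  exact DFunLike.congr_fun (F := (c ⟶ c') →₀ k) (hom_single_of_ne_right f (1 : k) c h.symm) g.1

lemma irredProj_single_endo {a : C} (f : a ⟶ a) : irredProj k c c' (single f 1) = 0 := by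
  by_cases ha : a = c
  · by_cases ha' : a = c'
    · subst ha ha'
      exact irredProj_single_of_not (not_isIrredHom_endo f)
    · exact irredProj_single_of_ne_right f ha'
  · exact irredProj_single_of_ne_left f ha

variable (F : (Representation.ofMulAction k (End c' × End c) (IrredHom c c')).IntertwiningMap
        (homRep k c c' U V))

lemma intertwining_endo_comp (hU : IsInflation (k := k) hC c U) (g : c ⟶ c) (f : c ⟶ c') (u : U) :
    F (irredProj k c c' (single (g ≫ f) 1)) u =
      F (irredProj k c c' (single f 1)) ((single g 1 : CategoryAlgebra k C) • u) := by
  by_cases hf : IsIrredHom f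
  -- The second factor acts through its inverse, so g⁻¹ produces precomposition with g.
  · let p : End c' × End c := (1, (End.of g)⁻¹)
    have hp : g ≫ f = (p • (⟨f, hf⟩ : IrredHom c c')).1 := by
      rw [irredHom_smul_val, inv_inv]
      exact (congrArg (g ≫ ·) (Category.comp_id f)).symm
    have h := Representation.IntertwiningMap.isIntertwining _ _ F p (MonoidAlgebra.single ⟨f, hf⟩ 1)
    rw [Representation.ofMulAction_single] at h
    rw [hp, irredProj_single, h, homRep_apply, ← irredProj_single, inv_inv, ← hU.single_smul]
    exact (congrArg (· • _) (map_one _)).trans (one_smul _ _)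
  · rw [irredProj_single_of_not hf, irredProj_single_of_not
      (fun h => hf ((isIrredHom_endo_comp_iff g f).mp h)), map_zero, LinearMap.zero_apply,
      LinearMap.zero_apply]

lemma intertwining_comp_endo (hV : IsInflation (k := k) hC c' V) (f : c ⟶ c') (g : c' ⟶ c')
    (u : U) : F (irredProj k c c' (single (f ≫ g) 1)) u =
      (single g 1 : CategoryAlgebra k C) • F (irredProj k c c' (single f 1)) u := by
  by_cases hf : IsIrredHom f
  · let p : End c' × End c := (End.of g, 1)
    have hp : f ≫ g = (p • (⟨f, hf⟩ : IrredHom c c')).1 := by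
      rw [irredHom_smul_val, inv_one]
      exact (Category.id_comp (f ≫ g)).symm
    have h := Representation.IntertwiningMap.isIntertwining _ _ F p (MonoidAlgebra.single ⟨f, hf⟩ 1)
    rw [Representation.ofMulAction_single] at h
    rw [hp, irredProj_single, h, homRep_apply, ← irredProj_single, inv_one, map_one, one_smul]
    exact (hV.single_smul (End.of g) _).symm
  · rw [irredProj_single_of_not hf, irredProj_single_of_not
      (fun h => hf ((isIrredHom_comp_endo_iff f g).mp h)), map_zero, LinearMap.zero_apply,
      smul_zero]

/-- For composable c → b → c', equivariance settles b = c and b = c'. For any other b all three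
terms vanish, the composite being reducible. With other outer objects, or without composability,
each term contains a zero projection or a zero action. -/
lemma intertwining_leibniz_single (hU : IsInflation (k := k) hC c U)
    (hV : IsInflation (k := k) hC c' V) {a b p q : C} (f : p ⟶ q) (g : a ⟶ b) (u : U) :
    F (irredProj k c c' (single f 1 * single g 1)) u =
      (single f 1 : CategoryAlgebra k C) • F (irredProj k c c' (single g 1)) u +
      F (irredProj k c c' (single f 1)) ((single g 1 : CategoryAlgebra k C) • u) := by
  by_cases hbp : b = p
  · subst hbp
    rw [single_mul_single, mul_one]
    by_cases ha : a = c
    · by_cases hq : q = c'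
      · subst ha hq
        by_cases hab : a = b
        · subst hab
          rw [intertwining_endo_comp F hU, irredProj_single_endo g, map_zero,
            LinearMap.zero_apply, smul_zero, zero_add]
        · by_cases hbq : b = q
          · subst hbq
            rw [intertwining_comp_endo F hV, irredProj_single_endo f, map_zero,
              LinearMap.zero_apply, add_zero]
          · rw [irredProj_single_of_not (not_isIrredHom_comp hC g f hab hbq),
              hU.single_smul_of_ne_right g (Ne.symm hab), hV.single_smul_of_ne_left f hbq,
              map_zero, map_zero, LinearMap.zero_apply, add_zero]
      · rw [irredProj_single_of_ne_right _ hq, irredProj_single_of_ne_right f hq,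
          hV.single_smul_of_ne_right f hq, map_zero, LinearMap.zero_apply, LinearMap.zero_apply,
          add_zero]
    · rw [irredProj_single_of_ne_left _ ha, irredProj_single_of_ne_left g ha,
        hU.single_smul_of_ne_left g ha, map_zero, map_zero, LinearMap.zero_apply, smul_zero,
        add_zero]
  · rw [single_mul_single_of_ne _ _ _ _ hbp, map_zero, map_zero, LinearMap.zero_apply]
    symm
    have h1 : (single f 1 : CategoryAlgebra k C) • F (irredProj k c c' (single g 1)) u = 0 := by
      by_cases hb : b = c'
      · exact hV.single_smul_of_ne_left f (fun hp => hbp (hb.trans hp.symm)) _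
      · rw [irredProj_single_of_ne_right g hb, map_zero, LinearMap.zero_apply, smul_zero]
    have h2 : F (irredProj k c c' (single f 1)) ((single g 1 : CategoryAlgebra k C) • u) = 0 := by
      by_cases hp : p = c
      · rw [hU.single_smul_of_ne_right g (fun hb => hbp (hb.trans hp.symm)), map_zero]
      · rw [irredProj_single_of_ne_left f hp, map_zero, LinearMap.zero_apply]
    rw [h1, h2, add_zero]

/-- Both sides of the Leibniz rule are bilinear in the algebra elements, so morphisms suffice;
endomorphisms project to zero, whence vanishing on B. -/
lemma intertwining_mem_relDer (hU : IsInflation (k := k) hC c U)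
    (hV : IsInflation (k := k) hC c' V) :
    F.toLinearMap.comp (irredProj k c c') ∈ relDer k (ofGroupAlgebras k) U V := by
  set D := F.toLinearMap.comp (irredProj k c c') with hD
  constructor
  · let φ := (LinearMap.mul k (CategoryAlgebra k C)).compr₂ D
    let ψ := ((LinearMap.llcomp k U V V).comp
        (Algebra.lsmul k k V : CategoryAlgebra k C →ₐ[k] _).toLinearMap).compl₂ D +
      ((LinearMap.llcomp k U U V).comp D).compl₂
        (Algebra.lsmul k k U : CategoryAlgebra k C →ₐ[k] _).toLinearMap
    have h : φ = ψ := bilinear_ext fun p q f a b g => LinearMap.ext fun u =>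
      intertwining_leibniz_single F hU hV f g u
    exact fun a b u => LinearMap.congr_fun (LinearMap.congr_fun₂ h a b) u
  · intro b
    rw [ofGroupAlgebras_apply, map_sum]
    refine Finset.sum_eq_zero fun d _ => ?_
    have h : D.comp (ofGroupAlgebra k d) = 0 := by
      refine MonoidAlgebra.lhom_ext' fun f => LinearMap.ext_ring ?_
      change F (irredProj k c c' (single f.asHom 1)) = 0
      rw [irredProj_single_endo, map_zero]
    exact LinearMap.congr_fun h (b d)

theorem relDerToIntertwining_bijective (hU : IsInflation (k := k) hC c U)
    (hV : IsInflation (k := k) hC c' V) : Function.Bijective (relDerToIntertwining hU hV) := by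
  constructor
  · refine (injective_iff_map_eq_zero _).mpr fun D h => Subtype.ext
      (relDer_eq_zero D.2 hU hV fun f hf => ?_)
    rw [← relDerToIntertwining_single hU hV D ⟨f, hf⟩, h]
    rfl
  · intro F
    refine ⟨⟨_, intertwining_mem_relDer F hU hV⟩, Representation.IntertwiningMap.ext
      (MonoidAlgebra.lhom_ext' fun f => LinearMap.ext_ring ?_)⟩
    refine (relDerToIntertwining_single hU hV _ f).trans ?_
    exact congrArg F (irredProj_single f)

end Derivations

/-! ### Counting arrows -/

section Arrows

open scoped ModuleCat

/-- The space U gets one k-action through kC and another through the group algebra; this identifies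
them, so that the `Ext¹` side and the multiplicity side concern the same Hom_k(U,V). -/
lemma module_eq_of_isScalarTower {k R M : Type*} [CommSemiring k] [Semiring R] [Algebra k R]
    [AddCommMonoid M] [Module R M] (i j : Module k M)
    (hi : @IsScalarTower k R M _ _ i.toSMul) (hj : @IsScalarTower k R M _ _ j.toSMul) : i = j := by
  have key (l : Module k M) (hl : @IsScalarTower k R M _ _ l.toSMul) (r : k) (x : M) :
      l.smul r x = (r • (1 : R)) • x := (smul_one_smul R r x).symm
  exact Module.ext' _ _ fun r x => (key i hi r x).trans (key j hj r x).symm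

variable {k : Type w} {C : Type u} [Field k] [Category.{v} C] [IsEI C]
  [∀ c d : C, Finite (c ⟶ d)] [∀ c : C, NeZero (Nat.card (End c) : k)]

lemma multiplicity_eq_rank_homRep (hsplit : ∀ c : C, IsSplittingField k (End c)) {c c' : C}
    (U : ModuleCat.{t} k[End c]) (V : ModuleCat.{t} k[End c']) [IsSimpleModule k[End c] U]
    [IsSimpleModule k[End c'] V] (i : Module k U) (j : Module k V)
    (hi : IsScalarTower k k[End c] U) (hj : IsScalarTower k k[End c'] V) :
    multiplicity k[End c' × End c]
        (Representation.ofMulAction k (End c' × End c) (IrredHom c c')).asModule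
        (tensorDual k V U).asModule =
      Cardinal.toENat (Module.rank k
        ((Representation.ofMulAction k (End c' × End c) (IrredHom c c')).IntertwiningMap
          (homRep k c c' U V))) := by
  obtain rfl := module_eq_of_isScalarTower (R := k[End c]) i
    (ModuleCat.moduleOfAlgebraModule U) hi (ModuleCat.isScalarTower_of_algebra_moduleCat U)
  obtain rfl := module_eq_of_isScalarTower (R := k[End c']) j
    (ModuleCat.moduleOfAlgebraModule V) hj (ModuleCat.isScalarTower_of_algebra_moduleCat V)
  exact multiplicity_tensorDual (hsplit c) (hsplit c') V U _

variable [Fintype C] (hC : Skeletal C)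

/-- The action of the group algebra on the underlying space of the inflation. -/
instance inflationModule (c : C) (U : ModuleCat.{t} k[End c]) :
    Module k[End c] ((inflation k hC c).obj U) :=
  U.isModule

omit [∀ c d : C, Finite (c ⟶ d)] [∀ c : C, NeZero (Nat.card (End c) : k)] in
lemma isInflation_inflation (c : C) (U : ModuleCat.{t} k[End c]) :
    IsInflation (k := k) hC c ((inflation k hC c).obj U) := fun _ _ => rfl

instance isScalarTower_inflation (c : C) (U : ModuleCat.{t} k[End c]) :
    IsScalarTower k k[End c] ((inflation k hC c).obj U) where
  smul_assoc r y x := by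
    have h (z : (inflation k hC c).obj U) : r • z = algebraMap k k[End c] r • z :=
      (isInflation_inflation hC c U (algebraMap k _ r) z).trans (by rw [AlgHom.commutes])
    rw [h, Algebra.smul_def, mul_smul]

theorem numArrows_eq_multiplicity (hsplit : ∀ c : C, IsSplittingField k (End c)) (c c' : C)
    (U : SimpleMod.{max u v w} k[End c]) (V : SimpleMod.{max u v w} k[End c']) :
    numArrows k (CategoryAlgebra k C) (vertexMap k hC ⟨c, Irr.mk U⟩)
        (vertexMap k hC ⟨c', Irr.mk V⟩) =
      multiplicity k[End c' × End c]
        (Representation.ofMulAction k (End c' × End c) (IrredHom c c')).asModule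
        (tensorDual k V.1 U.1).asModule := by
  have := U.2
  have := V.2
  let M := (inflation k hC c).obj U.1
  let N := (inflation k hC c').obj V.1
  change Cardinal.toENat (Module.rank k (Abelian.Ext M N 1)) = _
  have hker : ∀ a : CategoryAlgebra k C, ∃ b : (c : C) → k[End c],
      (∀ u : M, a • u = ofGroupAlgebras k b • u) ∧ ∀ v : N, a • v = ofGroupAlgebras k b • v := by
    intro a
    refine ⟨toGroupAlgebras k hC a, smul_eq_of_ker_smul hC (fun a ha x => ?_) a,
      smul_eq_of_ker_smul hC (fun a ha x => ?_) a⟩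
    · refine (inflation_smul hC c U.1 a x).trans ?_
      rw [show toGroupAlgebra k hC c a = 0 from congrFun ha c]
      exact @zero_smul k[End c] U.1 _ _ _ x
    · refine (inflation_smul hC c' V.1 a x).trans ?_
      rw [show toGroupAlgebra k hC c' a = 0 from congrFun ha c']
      exact @zero_smul k[End c'] V.1 _ _ _ x
  -- The count is the chain Ext¹ ≅ relative derivations ≅ equivariant maps.
  have e := LinearEquiv.ofBijective _ (relDerToExt_bijective (k := k) hker)
  have e' := LinearEquiv.ofBijective _ (relDerToIntertwining_bijective
    (isInflation_inflation hC c U.1) (isInflation_inflation hC c' V.1))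
  refine Eq.trans ?_ (multiplicity_eq_rank_homRep hsplit U.1 V.1 (ModuleCat.moduleOfAlgebraModule M)
    (ModuleCat.moduleOfAlgebraModule N) (isScalarTower_inflation hC c U.1)
    (isScalarTower_inflation hC c' V.1)).symm
  rw [← e.rank_eq]
  exact congrArg _ e'.rank_eq

end Arrows

end

end EIQuiver

theorem mainTheorem7 {C : Type u} [CategoryTheory.Category.{v} C] [Fintype C]
    [∀ c d : C, Finite (c ⟶ d)] [EIQuiver.IsEI C] (hC : CategoryTheory.Skeletal C)
    {k : Type w} [Field k]
    (hchar : ∀ c : C, ¬ ringChar k ∣ Nat.card (CategoryTheory.End c))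
    (hsplit : ∀ c : C, EIQuiver.IsSplittingField k (CategoryTheory.End c)) :
    EIQuiver.IsSplit k (EIQuiver.CategoryAlgebra k C) ∧
    Function.Bijective (EIQuiver.vertexMap.{max u v w} k hC) ∧
    ∀ (c c' : C) (U : EIQuiver.SimpleMod.{max u v w} (MonoidAlgebra k (CategoryTheory.End c)))
      (V : EIQuiver.SimpleMod.{max u v w} (MonoidAlgebra k (CategoryTheory.End c'))),
      EIQuiver.numArrows k (EIQuiver.CategoryAlgebra k C)
          (EIQuiver.vertexMap k hC ⟨c, EIQuiver.Irr.mk U⟩)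
          (EIQuiver.vertexMap k hC ⟨c', EIQuiver.Irr.mk V⟩) =
        EIQuiver.multiplicity
          (MonoidAlgebra k (CategoryTheory.End c' × CategoryTheory.End c))
          (Representation.ofMulAction k (CategoryTheory.End c' × CategoryTheory.End c)
            (EIQuiver.IrredHom c c')).asModule
          (EIQuiver.tensorDual k V.1 U.1).asModule := by
  -- The divisibility condition says exactly that the group order is nonzero in k, in characteristic
  -- zero as well; this is the form Maschke's theorem needs.
  have : ∀ c : C, NeZero (Nat.card (CategoryTheory.End c) : k) := fun c =>
    ⟨fun h => hchar c ((ringChar.spec k _).mp h)⟩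
  exact ⟨EIQuiver.isSplit_categoryAlgebra hC hsplit, ⟨EIQuiver.vertexMap_injective hC, EIQuiver.vertexMap_surjective hC⟩,
    EIQuiver.numArrows_eq_multiplicity hC hsplit⟩
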